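/- **Setting.** Let $\mathsf G,\tilde{\mathsf G}$ be second countable locally compact (Hausdorff) groups with units $\mathsf e,\varepsilon$ and left Haar measures. For a $C^*$-algebra $\mathscr A$, $\mathcal U\mathcal M(\mathscr A)$ denotes the unitary group of its multiplier algebra $\mathcal M(\mathscr A)$; automorphisms are extended to $\mathcal M(\mathscr A)$, and $\mathsf{ad}_u(A)=uAu^*$. "Measurable" means measurable with respect to (the completion of) Haar measure, strongly for maps into $\mathsf{Aut}(\mathscr A)$ and strictly for maps into $\mathcal U\mathcal M(\mathscr A)$. A *twisted action* of $\mathsf G$ on $\mathscr A$ is a pair $(\mathrm a,\alpha)$ of maps $\mathrm a:\mathsf G\to\mathsf{Aut}(\mathscr A)$, $\alpha:\mathsf G\times\mathsf G\to\mathcal U\mathcal M(\mathscr A)$ with $\mathrm a_{\mathsf e}=\mathrm{id}$, $\mathrm a_x\mathrm a_y=\mathsf{ad}_{\alpha(x,y)}\mathrm a_{xy}$, $\alpha(x,\mathsf e)=1=\alpha(\mathsf e,x)$ and $\alpha(x,y)\alpha(xy,z)=\mathrm a_x[\alpha(y,z)]\alpha(x,yz)$. It is *measurable* (resp. *continuous*)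 if $\mathrm a$ is strongly and $\alpha$ strictly measurable (resp. continuous). A *measurable* (resp. *continuous*) *covariant structure* $\{(\mathscr A,\kappa),(\mathrm a,\alpha),(\tilde{\mathrm a},\tilde\alpha)\}$ consists of a separable $C^*$-algebra $\mathscr A$, measurable (resp. continuous) twisted actions $(\mathrm a,\alpha)$ of $\mathsf G$ and $(\tilde{\mathrm a},\tilde\alpha)$ of $\tilde{\mathsf G}$ on $\mathscr A$, and a strictly continuous $\kappa:\mathsf G\times\tilde{\mathsf G}\to\mathcal U\mathcal M(\mathscr A)$ with $\kappa(\mathsf e,\xi)=1=\kappa(x,\varepsilon)$, such that for all $x,y\in\mathsf G$, $\xi,\eta\in\tilde{\mathsf G}$ $$\mathrm a_x\circ\tilde{\mathrm a}_\xi=\mathsf{ad}_{\kappa(x,\xi)}\circ\tilde{\mathrm a}_\xi\circ\mathrm a_x,\qquad \mathrm a_x[\tilde\alpha(\xi,\eta)]=\kappa(x,\xi)\,\tilde{\mathrm a}_\xi[\kappa(x,\eta)]\,\tilde\alpha(\xi,\eta)\,\kappa(x,\xi\eta)^*,$$ $$\tilde{\mathrm a}_\xi[\alpha(x,y)]=\kappa(x,\xi)^*\,\mathrm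 a_x[\kappa(y,\xi)^*]\,\alpha(x,y)\,\kappa(xy,\xi).$$ It is a measurable (resp. continuous) *$\mathsf G$-particular* covariant structure if in addition there is a strictly measurable (resp. strictly continuous) map $\rho:\mathsf G\to\mathcal U\mathcal M(\mathscr A)$ with $\rho_{\mathsf e}=1$, $\tilde{\mathrm a}_\xi(\rho_x)=\kappa(x,\xi)^*\rho_x$, $\mathrm a_x=\mathsf{ad}_{\rho_x}$ and $\alpha(x,y)=\rho_x\rho_y\rho_{xy}^*$ for all $x,y,\xi$. The *twisted crossed product* $\mathscr A\rtimes_{\mathrm a}^{\alpha}\mathsf G$ is the enveloping $C^*$-algebra of the Banach $^*$-algebra $L^1(\mathsf G;\mathscr A)$ with $$(f\diamond g)(x)=\int_{\mathsf G}f(y)\,\mathrm a_y[g(y^{-1}x)]\,\alpha(y,y^{-1}x)\,dy,\qquad f^\diamond(x)=\Delta_{\mathsf G}(x)^{-1}\alpha(x,x^{-1})^*\mathrm a_x[f(x^{-1})^*],$$ where the modular function $\Delta_{\mathsf G}$ is normalized so that $|Ex|=\Delta_{\mathsf G}(x)|E|$. For $z\in\mathsf G$ and $m\in\mathcal U\mathcal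 M(\mathscr A)$, $\delta_z\otimes m\in\mathcal U\mathcal M(\mathscr A\rtimes_{\mathrm a}^\alpha\mathsf G)$ is the multiplier which on (the images of) $f\in L^1(\mathsf G;\mathscr A)$ is $$[(\delta_z\otimes m)\diamond f](x)=m\,\mathrm a_z[f(z^{-1}x)]\,\alpha(z,z^{-1}x),\qquad [f\diamond(\delta_z\otimes m)](x)=\Delta_{\mathsf G}(z)^{-1}f(xz^{-1})\,\mathrm a_{xz^{-1}}(m)\,\alpha(xz^{-1},z).$$ **Theorem.** Let $\{(\mathscr A,\kappa),(\mathrm a,\alpha),(\tilde{\mathrm a},\tilde\alpha)\}$ be a measurable (resp. continuous) covariant structure. Then the formulas $$\mathsf k(x,\xi)=\delta_{\mathsf e}\otimes\kappa(x,\xi),\quad \lambda_x=\delta_x\otimes 1,\quad \mathrm b_x=\mathsf{ad}_{\lambda_x},\quad \beta(x,y)=\delta_{\mathsf e}\otimes\alpha(x,y)=\lambda_x\diamond\lambda_y\diamond\lambda_{xy}^{\diamond},$$ $$[\tilde{\mathrm b}_\xi(f)](y)=\tilde{\mathrm a}_\xi[f(y)]\,\kappa(y,\xi)^*\ \ (f\in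 L^1(\mathsf G;\mathscr A)),\quad \tilde\beta(\xi,\eta)=\delta_{\mathsf e}\otimes\tilde\alpha(\xi,\eta)$$ define a measurable (resp. continuous) $\mathsf G$-particular covariant structure $\{(\mathscr A\rtimes_{\mathrm a}^\alpha\mathsf G,\mathsf k),(\mathrm b,\beta),(\tilde{\mathrm b},\tilde\beta)\}$, with 1-cochain $\rho=\lambda$. -/

import Mathlib

open MeasureTheory Topology
open scoped ENNReal

noncomputable section

universe u v w

/-! ### Multipliers of a C⋆-algebra -/

section Multipliers

variable {A : Type w} [NonUnitalCStarAlgebra A]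

/-- The multiplier algebra `M(A)`: the double centralizers `m = (L, R)` of `A`. -/
abbrev Mult (A : Type w) [NonUnitalCStarAlgebra A] : Type w := DoubleCentralizer ℂ A

/-- The group `UM(A)` of unitary multipliers of `A`. -/
abbrev UMult (A : Type w) [NonUnitalCStarAlgebra A] : Type w := ↥(unitary (Mult A))

/-- The product `m a ∈ A` of a multiplier `m` and an element `a`. -/
def Mult.lmul (m : Mult A) (a : A) : A := m.fst a

/-- The product `a m ∈ A` of an element `a` and a multiplier `m`. -/
def Mult.rmul (a : A) (m : Mult A) : A := m.snd a

/-- The inner automorphism `ad_u(a) = u a u⋆` given by a unitary multiplier `u`. -/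
def UMult.ad (u : UMult A) (a : A) : A :=
  Mult.rmul (Mult.lmul (u : Mult A) a) (star (u : Mult A))

/-- A ⋆-automorphism of a C⋆-algebra as a continuous linear map. -/
def autCLM (φ : A ≃⋆ₐ[ℂ] A) : A →L[ℂ] A where
  toFun := φ
  map_add' := map_add φ
  map_smul' := map_smul φ
  cont := (StarAlgEquiv.isometry φ).continuous

/-- The canonical extension of an automorphism `φ` of `A` to the multiplier algebra:
`φ(m) a = φ(m φ⁻¹(a))` and `a φ(m) = φ(φ⁻¹(a) m)`. -/
def Mult.map (φ : A ≃⋆ₐ[ℂ] A) (m : Mult A) : Mult A where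
  fst := (autCLM φ).comp (m.fst.comp (autCLM φ.symm))
  snd := (autCLM φ).comp (m.snd.comp (autCLM φ.symm))
  central x y := by
    change φ (m.snd (φ.symm x)) * y = x * φ (m.fst (φ.symm y))
    have h := congrArg φ (m.central (φ.symm x) (φ.symm y))
    simpa using h

/-- Strict continuity of a multiplier-valued map. -/
def StrictlyContinuous {X : Type*} [TopologicalSpace X] (m : X → UMult A) : Prop :=
  ∀ a : A, Continuous (fun x => Mult.lmul (m x : Mult A) a) ∧
    Continuous (fun x => Mult.rmul a (m x : Mult A))

/-- Strict measurability of a multiplier-valued map, with respect to a (Haar) measure. -/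
def StrictlyMeasurable {X : Type*} [MeasurableSpace X] (μ : Measure X) (m : X → UMult A) : Prop :=
  ∀ a : A, AEStronglyMeasurable (fun x => Mult.lmul (m x : Mult A) a) μ ∧
    AEStronglyMeasurable (fun x => Mult.rmul a (m x : Mult A)) μ

end Multipliers

/-! ### Twisted actions -/

/-- A twisted action `(a, α)` of the group `G` on the C⋆-algebra `A`. -/
structure TwistedAction (G : Type u) (A : Type w) [Group G] [NonUnitalCStarAlgebra A] where
  /-- the automorphisms `a_x` -/
  act : G → (A ≃⋆ₐ[ℂ] A)
  /-- the 2-cocycle `α` -/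
  coc : G → G → UMult A
  act_one : ∀ b : A, act 1 b = b
  act_act : ∀ (x y : G) (b : A), act x (act y b) = (coc x y).ad (act (x * y) b)
  coc_one_right : ∀ x : G, coc x 1 = 1
  coc_one_left : ∀ x : G, coc 1 x = 1
  cocycle : ∀ x y z : G, (coc x y : Mult A) * (coc (x * y) z : Mult A) =
    Mult.map (act x) (coc y z : Mult A) * (coc x (y * z) : Mult A)

namespace TwistedAction

section Regularity

variable {G : Type u} {A : Type w} [Group G] [NonUnitalCStarAlgebra A]

/-- `a` is strongly measurable and `α` is strictly measurable (for the Haar measure). -/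
def IsMeasurable [MeasurableSpace G] (T : TwistedAction G A) (μ : Measure G) : Prop :=
  (∀ b : A, AEStronglyMeasurable (fun x => T.act x b) μ) ∧
    StrictlyMeasurable (μ.prod μ) (fun p : G × G => T.coc p.1 p.2)

/-- `a` is strongly continuous and `α` is strictly continuous. -/
def IsContinuous [TopologicalSpace G] (T : TwistedAction G A) : Prop :=
  (∀ b : A, Continuous (fun x => T.act x b)) ∧
    StrictlyContinuous (fun p : G × G => T.coc p.1 p.2)

end Regularity

end TwistedAction

/-! ### The modular function -/

section Modular

variable {G : Type u} [Group G] [TopologicalSpace G] [IsTopologicalGroup G] [LocallyCompactSpace G]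

/-- The modular function `Δ` of `G`, in the convention `μ(E x) = Δ(x) μ(E)` for a left Haar
measure `μ`, so that `∫ f(x⁻¹) Δ(x)⁻¹ dx = ∫ f(x) dx`. (It is the inverse of Mathlib's
`modularCharacter`, as the next lemma confirms.) -/
def modularFunction (x : G) : ℝ := ((Measure.modularCharacter x)⁻¹ : NNReal)

theorem measure_image_mul_right [MeasurableSpace G] [BorelSpace G] [SecondCountableTopology G]
    (μ : Measure G) [μ.IsHaarMeasure] (E : Set G) (x : G) :
    μ ((fun y => y * x) '' E) = ENNReal.ofReal (modularFunction x) * μ E := by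
  have h := Measure.map_right_mul_eq_modularCharacterFun_smul μ x⁻¹
  have h2 : (Measure.map (· * x⁻¹) μ) E = μ ((· * x⁻¹) ⁻¹' E) :=
    (Homeomorph.mulRight x⁻¹).measurableEmbedding.map_apply μ E
  have h3 : (fun y => y * x) '' E = (· * x⁻¹) ⁻¹' E := by
    ext y
    constructor
    · rintro ⟨z, hz, rfl⟩
      simpa using hz
    · intro hy
      exact ⟨y * x⁻¹, hy, by simp⟩
  have h4 : Measure.modularCharacterFun x⁻¹ = (Measure.modularCharacter x)⁻¹ := by
    change Measure.modularCharacter x⁻¹ = _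
    refine eq_inv_of_mul_eq_one_left ?_
    rw [← map_mul]
    simp
  rw [h3, ← h2, h, modularFunction, ENNReal.ofReal_coe_nnreal, h4]
  rfl

end Modular

/-! ### The twisted crossed product -/

namespace TwistedAction

variable {G : Type u} {A : Type w} [Group G] [TopologicalSpace G] [IsTopologicalGroup G]
  [LocallyCompactSpace G] [MeasurableSpace G] [NonUnitalCStarAlgebra A]

/-- The twisted convolution `(f ⋄ g)(x) = ∫ f(y) a_y[g(y⁻¹x)] α(y, y⁻¹x) dy`. -/
def conv (T : TwistedAction G A) (μ : Measure G) (f g : G → A) : G → A := fun x =>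
  ∫ y, Mult.rmul (f y * T.act y (g (y⁻¹ * x))) (T.coc y (y⁻¹ * x) : Mult A) ∂μ

/-- The twisted involution `f^⋄(x) = Δ(x)⁻¹ α(x, x⁻¹)⋆ a_x[f(x⁻¹)⋆]`. -/
def invol (T : TwistedAction G A) (f : G → A) : G → A := fun x =>
  (modularFunction x)⁻¹ •
    Mult.lmul (star (T.coc x x⁻¹ : Mult A)) (T.act x (star (f x⁻¹)))

/-- A ⋆-representation of the Banach ⋆-algebra `L¹(G; A)` (with the twisted convolution and
involution) by bounded operators on a Hilbert space. The products and adjoints are stated on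
classes: if `h ∈ L¹` is the class of `f ⋄ g`, then `π(h) = π(f) π(g)`, and likewise for `⋄`.
The bound `norm_le` is automatic for a ⋆-representation of a Banach ⋆-algebra. -/
structure L1Rep (T : TwistedAction G A) (μ : Measure G) where
  /-- the Hilbert space -/
  H : Type (max u w)
  [normed : NormedAddCommGroup H]
  [inner : InnerProductSpace ℂ H]
  [complete : CompleteSpace H]
  /-- the representation -/
  map : (G →₁[μ] A) →ₗ[ℂ] (H →L[ℂ] H)
  map_conv : ∀ f g h : G →₁[μ] A, (h =ᵐ[μ] T.conv μ f g) → map h = map f * map g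
  map_invol : ∀ f h : G →₁[μ] A, (h =ᵐ[μ] T.invol f) → map h = star (map f)
  norm_le : ∀ f : G →₁[μ] A, ‖map f‖ ≤ ‖f‖

attribute [instance] L1Rep.normed L1Rep.inner L1Rep.complete

/-- The product of the algebras of bounded operators of all representations of `L¹(G; A)`. -/
abbrev AllReps (T : TwistedAction G A) (μ : Measure G) : Type _ :=
  ↥(lp (fun π : T.L1Rep μ => π.H →L[ℂ] π.H) ∞)

/-- The universal representation of `L¹(G; A)`, the direct sum of all its representations. Its norm
`‖f‖ = sup_π ‖π(f)‖` is the enveloping C⋆-norm. -/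
def universalRep (T : TwistedAction G A) (μ : Measure G) (f : G →₁[μ] A) : T.AllReps μ :=
  ⟨fun π => π.map f, memℓp_infty ⟨‖f‖, by rintro _ ⟨π, rfl⟩; exact π.norm_le f⟩⟩

/-- The C⋆-algebra generated by the image of `L¹(G; A)` in its universal representation. -/
def envelope (T : TwistedAction G A) (μ : Measure G) : NonUnitalStarSubalgebra ℂ (T.AllReps μ) :=
  (NonUnitalStarAlgebra.adjoin ℂ (Set.range (T.universalRep μ))).topologicalClosure

/-- The twisted crossed product `A ⋊_a^α G`: the enveloping C⋆-algebra of `L¹(G; A)`. -/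
def CrossedProduct (T : TwistedAction G A) (μ : Measure G) : Type _ := ↥(T.envelope μ)

instance (T : TwistedAction G A) (μ : Measure G) : NonUnitalCStarAlgebra (T.CrossedProduct μ) :=
  NonUnitalStarSubalgebra.nonUnitalCStarAlgebra (T.envelope μ)
    (h_closed := NonUnitalStarSubalgebra.isClosed_topologicalClosure _)

/-- The canonical map `L¹(G; A) → A ⋊_a^α G`. -/
def ofL1 (T : TwistedAction G A) (μ : Measure G) (f : G →₁[μ] A) : T.CrossedProduct μ :=
  ⟨T.universalRep μ f, NonUnitalStarSubalgebra.le_topologicalClosure _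
    (NonUnitalStarAlgebra.subset_adjoin ℂ _ ⟨f, rfl⟩)⟩

/-- The multiplier `M` of `A ⋊_a^α G` is `δ_z ⊗ m`: it extends the double centralizer of
`L¹(G; A)` given by convolution with the measure `δ_z ⊗ m`, namely
`((δ_z ⊗ m) ⋄ f)(x) = m a_z[f(z⁻¹x)] α(z, z⁻¹x)` and
`(f ⋄ (δ_z ⊗ m))(x) = Δ(z)⁻¹ f(xz⁻¹) a_{xz⁻¹}(m) α(xz⁻¹, z)`. -/
structure IsDiracTensor (T : TwistedAction G A) (μ : Measure G) (z : G) (m : Mult A)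
    (M : Mult (T.CrossedProduct μ)) : Prop where
  left : ∀ f : G →₁[μ] A, ∃ h : G →₁[μ] A,
    (h =ᵐ[μ] fun x => Mult.rmul (Mult.lmul m (T.act z (f (z⁻¹ * x))))
      (T.coc z (z⁻¹ * x) : Mult A)) ∧
    Mult.lmul M (T.ofL1 μ f) = T.ofL1 μ h
  right : ∀ f : G →₁[μ] A, ∃ h : G →₁[μ] A,
    (h =ᵐ[μ] fun x => (modularFunction z)⁻¹ • Mult.rmul
      (Mult.rmul (f (x * z⁻¹)) (Mult.map (T.act (x * z⁻¹)) m))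
      (T.coc (x * z⁻¹) z : Mult A)) ∧
    Mult.rmul (T.ofL1 μ f) M = T.ofL1 μ h

end TwistedAction

/-! ### Covariant structures -/

/-- A covariant structure `{(A, κ), (a, α), (ã, α̃)}`: a separable C⋆-algebra with twisted actions
of `G` and `G̃` and a normalized strictly continuous coupling function `κ : G × G̃ → UM(A)`,
subject to the three compatibility relations. The regularity of the twisted actions is recorded
separately, in `IsMeasurable` and `IsContinuous`. -/
structure CovariantStructure (G : Type u) (Gt : Type v) (A : Type w) [Group G] [TopologicalSpace G]
    [Group Gt] [TopologicalSpace Gt] [NonUnitalCStarAlgebra A] where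
  separable : TopologicalSpace.SeparableSpace A
  /-- the twisted action `(a, α)` of `G` -/
  fstAct : TwistedAction G A
  /-- the twisted action `(ã, α̃)` of `G̃` -/
  sndAct : TwistedAction Gt A
  /-- the coupling function `κ` -/
  kappa : G → Gt → UMult A
  kappa_continuous : StrictlyContinuous (fun p : G × Gt => kappa p.1 p.2)
  kappa_one_left : ∀ ξ : Gt, kappa 1 ξ = 1
  kappa_one_right : ∀ x : G, kappa x 1 = 1
  /-- `a_x ∘ ã_ξ = ad_{κ(x,ξ)} ∘ ã_ξ ∘ a_x` -/
  act_comm : ∀ (x : G) (ξ : Gt) (b : A),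
    fstAct.act x (sndAct.act ξ b) = (kappa x ξ).ad (sndAct.act ξ (fstAct.act x b))
  /-- `a_x[α̃(ξ,η)] = κ(x,ξ) ã_ξ[κ(x,η)] α̃(ξ,η) κ(x,ξη)⋆` -/
  act_sndCoc : ∀ (x : G) (ξ η : Gt),
    Mult.map (fstAct.act x) (sndAct.coc ξ η : Mult A) =
      (kappa x ξ : Mult A) * Mult.map (sndAct.act ξ) (kappa x η : Mult A) *
        (sndAct.coc ξ η : Mult A) * star (kappa x (ξ * η) : Mult A)
  /-- `ã_ξ[α(x,y)] = κ(x,ξ)⋆ a_x[κ(y,ξ)⋆] α(x,y) κ(xy,ξ)` -/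
  act_fstCoc : ∀ (x y : G) (ξ : Gt),
    Mult.map (sndAct.act ξ) (fstAct.coc x y : Mult A) =
      star (kappa x ξ : Mult A) * Mult.map (fstAct.act x) (star (kappa y ξ : Mult A)) *
        (fstAct.coc x y : Mult A) * (kappa (x * y) ξ : Mult A)

namespace CovariantStructure

section Basic

variable {G : Type u} {Gt : Type v} {A : Type w} [Group G] [TopologicalSpace G]
    [Group Gt] [TopologicalSpace Gt] [NonUnitalCStarAlgebra A]

/-- A measurable covariant structure: both twisted actions are measurable. -/
def IsMeasurable [MeasurableSpace G] [MeasurableSpace Gt] (S : CovariantStructure G Gt A)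
    (μ : Measure G) (ν : Measure Gt) : Prop :=
  S.fstAct.IsMeasurable μ ∧ S.sndAct.IsMeasurable ν

/-- A continuous covariant structure: both twisted actions are continuous. -/
def IsContinuous (S : CovariantStructure G Gt A) : Prop :=
  S.fstAct.IsContinuous ∧ S.sndAct.IsContinuous

/-- The covariant structure is `G`-particular, by means of the 1-cochain `ρ : G → UM(A)`. -/
structure IsParticular (S : CovariantStructure G Gt A) (ρ : G → UMult A) : Prop where
  rho_one : ρ 1 = 1
  /-- the covariance condition `ã_ξ(ρ_x) = κ(x,ξ)⋆ ρ_x` -/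
  covariance : ∀ (x : G) (ξ : Gt), Mult.map (S.sndAct.act ξ) (ρ x : Mult A) =
    star (S.kappa x ξ : Mult A) * (ρ x : Mult A)
  /-- `a_x = ad_{ρ_x}` -/
  act_eq : ∀ (x : G) (b : A), S.fstAct.act x b = (ρ x).ad b
  /-- `α(x,y) = ρ_x ρ_y ρ_{xy}⋆` -/
  coc_eq : ∀ x y : G, (S.fstAct.coc x y : Mult A) =
    (ρ x : Mult A) * (ρ y : Mult A) * star (ρ (x * y) : Mult A)

/-- A measurable `G`-particular covariant structure, with strictly measurable 1-cochain `ρ`. -/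
def IsMeasurableParticular [MeasurableSpace G] [MeasurableSpace Gt] (S : CovariantStructure G Gt A)
    (μ : Measure G) (ν : Measure Gt) (ρ : G → UMult A) : Prop :=
  S.IsParticular ρ ∧ S.IsMeasurable μ ν ∧ StrictlyMeasurable μ ρ

/-- A continuous `G`-particular covariant structure, with strictly continuous 1-cochain `ρ`. -/
def IsContinuousParticular (S : CovariantStructure G Gt A) (ρ : G → UMult A) : Prop :=
  S.IsParticular ρ ∧ S.IsContinuous ∧ StrictlyContinuous ρ

end Basic

variable {G : Type u} {Gt : Type v} {A : Type w} [Group G] [TopologicalSpace G]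
    [IsTopologicalGroup G] [LocallyCompactSpace G] [MeasurableSpace G]
    [Group Gt] [TopologicalSpace Gt] [NonUnitalCStarAlgebra A]

/-- `S'` is the covariant structure `{(A ⋊_a^α G, k), (b, β), (b̃, β̃)}` attached to `S`,
and `lam` is the family `λ`, as given by the explicit formulas. (All these data are determined by
`S`, as the image of `L¹(G; A)` is dense in the twisted crossed product.) -/
structure IsFirstGeneration (S : CovariantStructure G Gt A) (μ : Measure G)
    (S' : CovariantStructure G Gt (S.fstAct.CrossedProduct μ))
    (lam : G → UMult (S.fstAct.CrossedProduct μ)) : Prop where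
  /-- `λ_x = δ_x ⊗ 1` -/
  lam_eq : ∀ x : G, S.fstAct.IsDiracTensor μ x 1 (lam x : Mult (S.fstAct.CrossedProduct μ))
  /-- `k(x,ξ) = δ_e ⊗ κ(x,ξ)` -/
  kappa_eq : ∀ (x : G) (ξ : Gt), S.fstAct.IsDiracTensor μ 1 (S.kappa x ξ : Mult A)
    (S'.kappa x ξ : Mult (S.fstAct.CrossedProduct μ))
  /-- `b_x = ad_{λ_x}` -/
  fstAct_eq : ∀ (x : G) (F : S.fstAct.CrossedProduct μ), S'.fstAct.act x F = (lam x).ad F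
  /-- `β(x,y) = δ_e ⊗ α(x,y)` -/
  fstCoc_eq : ∀ x y : G, S.fstAct.IsDiracTensor μ 1 (S.fstAct.coc x y : Mult A)
    (S'.fstAct.coc x y : Mult (S.fstAct.CrossedProduct μ))
  /-- `b̃_ξ(f)(y) = ã_ξ[f(y)] κ(y,ξ)⋆` for `f ∈ L¹(G; A)` -/
  sndAct_eq : ∀ (ξ : Gt) (f : G →₁[μ] A), ∃ h : G →₁[μ] A,
    (h =ᵐ[μ] fun y => Mult.rmul (S.sndAct.act ξ (f y)) (star (S.kappa y ξ : Mult A))) ∧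
    S'.sndAct.act ξ (S.fstAct.ofL1 μ f) = S.fstAct.ofL1 μ h
  /-- `β̃(ξ,η) = δ_e ⊗ α̃(ξ,η)` -/
  sndCoc_eq : ∀ ξ η : Gt, S.fstAct.IsDiracTensor μ 1 (S.sndAct.coc ξ η : Mult A)
    (S'.sndAct.coc ξ η : Mult (S.fstAct.CrossedProduct μ))

end CovariantStructure

end

/-!
The twisted crossed product `B = A ⋊ G` is the completion of the Banach ⋆-algebra `L¹(G; A)` in its
universal representation, so everything is first built on functions and then extended.

For a unitary multiplier `m`, convolution by `δ_z ⊗ m` on the left and on the right is a double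
centralizer of `L¹(G; A)` (`conv_diracLeft`), and it is unitary in the sense that
`(f⋆ ⋄ (δ_z ⊗ m)⋆) ⋄ (δ_z ⊗ m) = f⋆` (`diracRight_invol_diracLeft`). Hence it preserves `f⋆ ⋄ g`, is
isometric for the enveloping norm, and extends to a unitary multiplier of `B`
(`UMult.exists_of_denseRange`). The map `ã_ξ[f(y)] κ(y, ξ)⋆` is an isometric ⋆-automorphism of
`L¹(G; A)`; composition with it permutes the representations of `L¹(G; A)`, so it preserves the
enveloping norm and extends to `B` (`CovariantStructure.exists_sndAut`).

All the relations come from three formulas, each a pointwise identity between functions: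
`(δ_z ⊗ m)(δ_w ⊗ n) = δ_{zw} ⊗ m a_z(n) α(z, w)` (`dirac_mul_dirac`),
`b̃_ξ(δ_z ⊗ m) = δ_z ⊗ ã_ξ(m) κ(z, ξ)⋆` (`map_sndAut_dirac`), and
`b̃_ξ b̃_η = ad_{β̃(ξ, η)} b̃_{ξη}` (`sndAut_sndAut`).
By the first, `m ↦ δ_e ⊗ m` is a homomorphism of unitary groups that intertwines `a_x` with
`ad_{λ_x}`; by the second, it intertwines `ã_ξ` with `b̃_ξ`. Applying it to the cocycle and coupling
relations of the given structure yields those of the new one. The pointwise identities are verified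
in the monoid `M(A)`, which contains `A`.

In the measurable case `α` is only jointly measurable up to null sets, while the formula for
`δ_z ⊗ m` needs `α(z, ·)` and `α(·, z)` for every `z`; the cocycle identity supplies this
(`IsMeasurable.coc_left`, `IsMeasurable.coc_right`). Regularity of the new structure is checked on
the dense image of `L¹(G; A)`, by dominated convergence or by Fubini's theorem; for unitary families
left multiplication is enough (`StrictlyMeasurable.of_lmul`, `StrictlyContinuous.of_lmul`).
-/

noncomputable section

/-! ### The multiplier algebra -/

section MultiplierCalculus

variable {A : Type w} [NonUnitalCStarAlgebra A]

namespace Mult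

/-- The embedding of a C⋆-algebra into its multiplier algebra. Through it, pointwise identities
mixing elements and multipliers become identities in the monoid `M(A)`. -/
def of (a : A) : Mult A := DoubleCentralizer.coe ℂ a

theorem ext_lmul {m n : Mult A} (h : ∀ a, lmul m a = lmul n a) : m = n := by
  have h1 : (m - n).fst = 0 := by
    ext a
    have := h a
    simp only [lmul] at this
    simp [this]
  have h2 : ‖m - n‖ = 0 := by rw [← DoubleCentralizer.norm_fst, h1, norm_zero]
  exact sub_eq_zero.1 (norm_eq_zero.1 h2)

theorem rmul_mul (a : A) (m : Mult A) (b : A) : rmul a m * b = a * lmul m b := m.central a b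

theorem lmul_mul (m : Mult A) (a b : A) : lmul m (a * b) = lmul m a * b := by
  have key : ∀ c : A, c * (lmul m (a * b) - lmul m a * b) = 0 := fun c => by
    rw [mul_sub, ← mul_assoc, ← rmul_mul, ← rmul_mul, mul_assoc, sub_self]
  have := key (star (lmul m (a * b) - lmul m a * b))
  exact sub_eq_zero.1 ((CStarRing.star_mul_self_eq_zero_iff _).1 this)

theorem lmul_of (a b : A) : lmul (of a) b = a * b := rfl

theorem mul_lmul (m n : Mult A) (a : A) : lmul (m * n) a = lmul m (lmul n a) := rfl

theorem star_lmul (m : Mult A) (a : A) : star (lmul m a) = rmul (star a) (star m) := by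
  simp [lmul, rmul]

theorem star_rmul (m : Mult A) (a : A) : star (rmul a m) = lmul (star m) (star a) := by
  simp [lmul, rmul]

theorem of_lmul (m : Mult A) (a : A) : of (lmul m a) = m * of a :=
  ext_lmul fun b => by rw [lmul_of, mul_lmul, lmul_of, lmul_mul]

theorem of_rmul (m : Mult A) (a : A) : of (rmul a m) = of a * m :=
  ext_lmul fun b => by rw [lmul_of, mul_lmul, lmul_of, rmul_mul]

theorem of_mul (a b : A) : of (a * b) = of a * of b :=
  ext_lmul fun c => by rw [lmul_of, mul_lmul, lmul_of, lmul_of, mul_assoc]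

theorem of_star (a : A) : of (star a) = star (of a) :=
  map_star (DoubleCentralizer.coeHom (𝕜 := ℂ) (A := A)) a

theorem of_smul (c : ℝ) (a : A) : of (c • a) = c • of a :=
  ext_lmul fun b => by rw [lmul_of, smul_mul_assoc]; rfl

theorem of_injective : Function.Injective (of : A → Mult A) := fun a b h => by
  have : ∀ c, (a - b) * c = 0 := fun c => by
    rw [sub_mul, ← lmul_of, ← lmul_of, h, sub_self]
  exact sub_eq_zero.1 ((CStarRing.mul_star_self_eq_zero_iff _).1 (this _))

theorem norm_of (a : A) : ‖of a‖ = ‖a‖ := by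
  have h : Function.Injective (DoubleCentralizer.coeHom (𝕜 := ℂ) (A := A)) := of_injective
  exact NonUnitalStarAlgHom.norm_map (DoubleCentralizer.coeHom (𝕜 := ℂ) (A := A)) h a

theorem lmul_map (φ : A ≃⋆ₐ[ℂ] A) (m : Mult A) (a : A) :
    lmul (map φ m) a = φ (lmul m (φ.symm a)) := rfl

theorem map_of (φ : A ≃⋆ₐ[ℂ] A) (a : A) : map φ (of a) = of (φ a) :=
  ext_lmul fun b => by rw [lmul_map, lmul_of, lmul_of, map_mul, StarAlgEquiv.apply_symm_apply]

theorem map_mul (φ : A ≃⋆ₐ[ℂ] A) (m n : Mult A) : map φ (m * n) = map φ m * map φ n :=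
  ext_lmul fun b => by
    rw [mul_lmul, lmul_map, lmul_map, lmul_map, StarAlgEquiv.symm_apply_apply, mul_lmul]

theorem map_one (φ : A ≃⋆ₐ[ℂ] A) : map φ 1 = 1 :=
  ext_lmul fun b => by
    rw [lmul_map]
    change φ (φ.symm b) = b
    simp

theorem map_star (φ : A ≃⋆ₐ[ℂ] A) (m : Mult A) : map φ (star m) = star (map φ m) :=
  ext_lmul fun b => by
    rw [lmul_map]
    change φ ((star m).fst (φ.symm b)) = (star (map φ m)).fst b
    rw [DoubleCentralizer.star_fst, DoubleCentralizer.star_fst]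
    change φ (star (m.snd (star (φ.symm b)))) = star (φ (m.snd (φ.symm (star b))))
    rw [StarHomClass.map_star φ, StarHomClass.map_star φ.symm]

theorem map_of_id {φ : A ≃⋆ₐ[ℂ] A} (h : ∀ a, φ a = a) (m : Mult A) : map φ m = m :=
  ext_lmul fun b => by
    rw [lmul_map, h]
    congr 1
    rw [← h (φ.symm b), StarAlgEquiv.apply_symm_apply]

end Mult

namespace UMult

@[simp] theorem star_coe_mul_coe (u : UMult A) : star (u : Mult A) * u = 1 :=
  (Unitary.mem_iff.1 u.2).1

@[simp] theorem coe_mul_star_coe (u : UMult A) : (u : Mult A) * star (u : Mult A) = 1 :=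
  (Unitary.mem_iff.1 u.2).2

@[simp] theorem star_coe_mul_coe_mul (u : UMult A) (m : Mult A) :
    star (u : Mult A) * (u * m) = m := by
  rw [← mul_assoc, star_coe_mul_coe, one_mul]

@[simp] theorem coe_mul_star_coe_mul (u : UMult A) (m : Mult A) :
    (u : Mult A) * (star (u : Mult A) * m) = m := by
  rw [← mul_assoc, coe_mul_star_coe, one_mul]

theorem coe_inv (u : UMult A) : ((u⁻¹ : UMult A) : Mult A) = star (u : Mult A) := rfl

theorem norm_lmul (u : UMult A) (a : A) : ‖Mult.lmul (u : Mult A) a‖ = ‖a‖ := by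
  rw [← Mult.norm_of, Mult.of_lmul, CStarRing.norm_coe_unitary_mul, Mult.norm_of]

theorem norm_rmul (u : UMult A) (a : A) : ‖Mult.rmul a (u : Mult A)‖ = ‖a‖ := by
  rw [← Mult.norm_of, Mult.of_rmul, CStarRing.norm_mul_coe_unitary, Mult.norm_of]

/-- The extension of an automorphism of `A` to the unitary group of the multiplier algebra. -/
def map (φ : A ≃⋆ₐ[ℂ] A) : UMult A →* UMult A where
  toFun u := ⟨Mult.map φ u, by
    rw [Unitary.mem_iff]
    constructor
    · rw [← Mult.map_star, ← Mult.map_mul, star_coe_mul_coe, Mult.map_one]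
    · rw [← Mult.map_star, ← Mult.map_mul, coe_mul_star_coe, Mult.map_one]⟩
  map_one' := Subtype.ext (Mult.map_one φ)
  map_mul' u v := Subtype.ext (Mult.map_mul φ u v)

@[simp] theorem coe_map (φ : A ≃⋆ₐ[ℂ] A) (u : UMult A) :
    ((map φ u : UMult A) : Mult A) = Mult.map φ u := rfl

theorem of_ad (u : UMult A) (a : A) : Mult.of (u.ad a) = u * Mult.of a * star (u : Mult A) := by
  rw [ad, Mult.of_rmul, Mult.of_lmul]

/-- The inner automorphism `ad_u` as a ⋆-automorphism. -/
def adEquiv (u : UMult A) : A ≃⋆ₐ[ℂ] A where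
  toFun := u.ad
  invFun := (u⁻¹).ad
  left_inv a := Mult.of_injective <| by simp [of_ad, coe_inv, mul_assoc]
  right_inv a := Mult.of_injective <| by simp [of_ad, coe_inv, mul_assoc]
  map_mul' a b := Mult.of_injective <| by
    rw [of_ad, Mult.of_mul, Mult.of_mul, of_ad, of_ad]
    simp only [mul_assoc, star_coe_mul_coe_mul]
  map_add' a b := by simp [ad, Mult.rmul, Mult.lmul]
  map_smul' c a := by simp [ad, Mult.rmul, Mult.lmul]
  map_star' a := Mult.of_injective <| by
    rw [of_ad, Mult.of_star, Mult.of_star, of_ad]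
    simp [mul_assoc]

@[simp] theorem adEquiv_apply (u : UMult A) (a : A) : u.adEquiv a = u.ad a := rfl

theorem map_adEquiv (u v : UMult A) : map u.adEquiv v = u * v * u⁻¹ :=
  Subtype.ext <| Mult.ext_lmul fun a => Mult.of_injective <| by
    change Mult.of (u.ad (Mult.lmul v ((u⁻¹).ad a))) = _
    rw [of_ad, Mult.of_lmul, of_ad, Mult.of_lmul]
    simp [coe_inv, mul_assoc]

end UMult

end MultiplierCalculus

/-! ### Extension from a dense range -/

section Extension

variable {B : Type w} [NonUnitalCStarAlgebra B] {E : Type v} [AddCommGroup E] [Module ℂ E]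

/-- A pair of linear maps that behave, on a dense subspace, as left and right multiplication by a
unitary extends to a unitary multiplier. No adjoint has to be supplied: being isometric for the
`B`-valued inner products on both sides already makes the double centralizer unitary. -/
theorem UMult.exists_of_denseRange (ι : E →ₗ[ℂ] B) (hι : DenseRange ι) (L R : E →ₗ[ℂ] E)
    (hL : ∀ f g, star (ι (L f)) * ι (L g) = star (ι f) * ι g)
    (hR : ∀ f g, ι (R f) * star (ι (R g)) = ι f * star (ι g))
    (hc : ∀ f g, ι (R f) * ι g = ι f * ι (L g)) :
    ∃ u : UMult B, ∀ f, Mult.lmul (u : Mult B) (ι f) = ι (L f) ∧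
      Mult.rmul (ι f) (u : Mult B) = ι (R f) := by
  have nL : ∀ f, ‖ι (L f)‖ = ‖ι f‖ := fun f => by
    have := congrArg norm (hL f f)
    rw [CStarRing.norm_star_mul_self, CStarRing.norm_star_mul_self] at this
    exact (mul_self_inj (norm_nonneg _) (norm_nonneg _)).1 this
  have nR : ∀ f, ‖ι (R f)‖ = ‖ι f‖ := fun f => by
    have := congrArg norm (hR f f)
    rw [CStarRing.norm_self_mul_star, CStarRing.norm_self_mul_star] at this
    exact (mul_self_inj (norm_nonneg _) (norm_nonneg _)).1 this
  set L' := (ι ∘ₗ L).extendOfNorm ι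
  set R' := (ι ∘ₗ R).extendOfNorm ι
  have eL : ∀ f, L' (ι f) = ι (L f) := fun f =>
    LinearMap.extendOfNorm_eq hι ⟨1, fun x => by simp [nL]⟩ f
  have eR : ∀ f, R' (ι f) = ι (R f) := fun f =>
    LinearMap.extendOfNorm_eq hι ⟨1, fun x => by simp [nR]⟩ f
  let M : Mult B :=
    { fst := L'
      snd := R'
      central := fun a b => by
        refine hι.induction_on₂ (p := fun a b => R' a * b = a * L' b) ?_ ?_ a b
        · exact isClosed_eq (by fun_prop) (by fun_prop)
        · intro f g
          rw [eL, eR, hc] }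
  have iL : ∀ a b : B, star (L' a) * L' b = star a * b := fun a b => by
    refine hι.induction_on₂ (p := fun a b => star (L' a) * L' b = star a * b) ?_ ?_ a b
    · exact isClosed_eq (by fun_prop) (by fun_prop)
    · intro f g
      rw [eL, eL, hL]
  have iR : ∀ a b : B, R' a * star (R' b) = a * star b := fun a b => by
    refine hι.induction_on₂ (p := fun a b => R' a * star (R' b) = a * star b) ?_ ?_ a b
    · exact isClosed_eq (by fun_prop) (by fun_prop)
    · intro f g
      rw [eR, eR, hR]
  have hM : M ∈ unitary (Mult B) := by
    rw [Unitary.mem_iff]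
    constructor
    · refine Mult.ext_lmul fun b => ?_
      -- `star (M c) * (M b) = star c * b` for all `c` forces `star M * M * b = b`.
      have key : ∀ c : B, c * (Mult.lmul (star M * M) b - b) = 0 := fun c => by
        rw [mul_sub, sub_eq_zero, Mult.mul_lmul, ← Mult.rmul_mul]
        have := iL (star c) b
        rw [star_star] at this
        rw [← this, ← star_star (Mult.rmul c (star M)), Mult.star_rmul, star_star]
        rfl
      have := key (star (Mult.lmul (star M * M) b - b))
      exact sub_eq_zero.1 ((CStarRing.star_mul_self_eq_zero_iff _).1 this)
    · refine Mult.ext_lmul fun b => ?_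
      have key : ∀ c : B, c * (Mult.lmul (M * star M) b - b) = 0 := fun c => by
        rw [mul_sub, sub_eq_zero, Mult.mul_lmul, ← Mult.rmul_mul]
        have := iR c (star b)
        rw [star_star] at this
        rw [← this, ← star_star (Mult.lmul (star M) b), Mult.star_lmul, star_star]
        rfl
      have := key (star (Mult.lmul (M * star M) b - b))
      exact sub_eq_zero.1 ((CStarRing.star_mul_self_eq_zero_iff _).1 this)
  exact ⟨⟨M, hM⟩, fun f => ⟨eL f, eR f⟩⟩

/-- An isometric ⋆-automorphism of a dense ⋆-subalgebra extends to its completion. -/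
theorem StarAlgEquiv.exists_of_denseRange (ι : E →ₗ[ℂ] B) (hι : DenseRange ι) (Θ Θ' : E →ₗ[ℂ] E)
    (h₁ : ∀ f, ι (Θ (Θ' f)) = ι f) (h₂ : ∀ f, ι (Θ' (Θ f)) = ι f)
    (hn : ∀ f, ‖ι (Θ f)‖ = ‖ι f‖)
    (hmul : ∀ f g, ∃ h, ι h = ι f * ι g ∧ ι (Θ h) = ι (Θ f) * ι (Θ g))
    (hstar : ∀ f, ∃ h, ι h = star (ι f) ∧ ι (Θ h) = star (ι (Θ f))) :
    ∃ φ : B ≃⋆ₐ[ℂ] B, ∀ f, φ (ι f) = ι (Θ f) := by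
  have hn' : ∀ f, ‖ι (Θ' f)‖ = ‖ι f‖ := fun f => by rw [← hn, h₁]
  set F := (ι ∘ₗ Θ).extendOfNorm ι
  set F' := (ι ∘ₗ Θ').extendOfNorm ι
  have e : ∀ f, F (ι f) = ι (Θ f) := fun f =>
    LinearMap.extendOfNorm_eq hι ⟨1, fun x => by simp [hn]⟩ f
  have e' : ∀ f, F' (ι f) = ι (Θ' f) := fun f =>
    LinearMap.extendOfNorm_eq hι ⟨1, fun x => by simp [hn']⟩ f
  refine ⟨{ toFun := F, invFun := F', left_inv := fun a => ?_, right_inv := fun a => ?_,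
            map_mul' := fun a b => ?_, map_add' := map_add F, map_smul' := map_smul F,
            map_star' := fun a => ?_ }, e⟩
  · refine hι.induction_on (p := fun a => F' (F a) = a) a
      (isClosed_eq (by fun_prop) (by fun_prop)) fun f => ?_
    rw [e, e', h₂]
  · refine hι.induction_on (p := fun a => F (F' a) = a) a
      (isClosed_eq (by fun_prop) (by fun_prop)) fun f => ?_
    rw [e', e, h₁]
  · refine hι.induction_on₂ (p := fun a b => F (a * b) = F a * F b)
      (isClosed_eq (by fun_prop) (by fun_prop)) (fun f g => ?_) a b
    obtain ⟨h, hh, hh'⟩ := hmul f g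
    rw [← hh, e, e, e, hh']
  · refine hι.induction_on (p := fun a => F (star a) = star (F a)) a
      (isClosed_eq (by fun_prop) (by fun_prop)) fun f => ?_
    obtain ⟨h, hh, hh'⟩ := hstar f
    rw [← hh, e, e, hh']

end Extension

/-! ### Families of isometries: measurability and continuity -/

section Families

variable {X : Type*} {B : Type*} [MetricSpace B]

/-- Balls generate the Borel sets of a separable metric space, so measurability of the distances to
all points suffices. This is what makes inverses of measurable families of isometries measurable. -/
theorem aestronglyMeasurable_of_dist [SecondCountableTopology B] [MeasurableSpace X]
    {μ : Measure X} {F : X → B} (h : ∀ c, AEMeasurable (fun x => dist (F x) c) μ) :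
    AEStronglyMeasurable F μ := by
  borelize B
  refine AEMeasurable.aestronglyMeasurable (NullMeasurable.aemeasurable ?_)
  refine measurable_of_isOpen (γ := B) (δ := NullMeasurableSpace X μ) fun U hU => ?_
  change NullMeasurableSet (F ⁻¹' U) μ
  let s : {p : B × ℝ // Metric.ball p.1 p.2 ⊆ U} → Set B := fun p => Metric.ball p.1.1 p.1.2
  obtain ⟨T, hT, hTU⟩ := TopologicalSpace.isOpen_iUnion_countable s fun p => Metric.isOpen_ball
  have hU' : U = ⋃ i, s i := by
    refine Set.Subset.antisymm (fun b hb => ?_) (Set.iUnion_subset fun p => p.2)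
    obtain ⟨ε, hε, hb'⟩ := Metric.isOpen_iff.1 hU b hb
    exact Set.mem_iUnion.2 ⟨⟨(b, ε), hb'⟩, Metric.mem_ball_self hε⟩
  rw [hU', ← hTU, Set.preimage_iUnion₂]
  refine NullMeasurableSet.biUnion hT fun p _ => ?_
  exact (h p.1.1).nullMeasurable measurableSet_Iio

theorem aestronglyMeasurable_apply [MeasurableSpace X] {μ : Measure X} {T : X → B → B}
    (hc : ∀ x, Continuous (T x)) (hT : ∀ b, AEStronglyMeasurable (fun x => T x b) μ) {F : X → B}
    (hF : AEStronglyMeasurable F μ) : AEStronglyMeasurable (fun x => T x (F x)) μ := by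
  have hs : ∀ s : SimpleFunc X B, AEStronglyMeasurable (fun x => T x (s x)) μ := fun s => by
    rcases isEmpty_or_nonempty X with hX | ⟨⟨x₀⟩⟩
    · exact (StronglyMeasurable.of_subsingleton_dom).aestronglyMeasurable
    have : Nonempty B := ⟨s x₀⟩
    induction s using SimpleFunc.induction' with
    | const c => exact hT c
    | @pcw f g t ht hf hg =>
      classical
      refine ((hf.mono_measure (Measure.restrict_le_self (s := t))).piecewise ht
        (hg.mono_measure Measure.restrict_le_self)).congr
        (Filter.Eventually.of_forall fun x => ?_)
      by_cases hx : x ∈ t <;> simp [hx]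
  refine (aestronglyMeasurable_of_tendsto_ae Filter.atTop
    (f := fun n x => T x (hF.stronglyMeasurable_mk.approx n x)) (fun n => hs _)
    (g := fun x => T x (hF.mk F x)) ?_).congr ?_
  · exact Filter.Eventually.of_forall fun x =>
      ((hc x).tendsto _).comp (hF.stronglyMeasurable_mk.tendsto_approx x)
  · filter_upwards [hF.ae_eq_mk] with x hx
    rw [hx]

theorem aestronglyMeasurable_of_denseRange [MeasurableSpace X] {μ : Measure X} {T : X → B → B}
    (hc : ∀ x, Continuous (T x)) {E : Type*} {ι : E → B} (hι : DenseRange ι)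
    (hT : ∀ f, AEStronglyMeasurable (fun x => T x (ι f)) μ) (b : B) :
    AEStronglyMeasurable (fun x => T x b) μ := by
  obtain ⟨s, hs, hsb⟩ := mem_closure_iff_seq_limit.1 (hι b)
  choose f hf using hs
  refine aestronglyMeasurable_of_tendsto_ae Filter.atTop (f := fun n x => T x (s n))
    (fun n => hf n ▸ hT (f n)) (Filter.Eventually.of_forall fun x => ?_)
  exact ((hc x).tendsto _).comp hsb

theorem continuous_apply_of_isometry [TopologicalSpace X] {T : X → B → B}
    (hc : ∀ x, Isometry (T x)) (hT : ∀ b, Continuous (fun x => T x b)) {F : X → B}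
    (hF : Continuous F) : Continuous (fun x => T x (F x)) := by
  refine continuous_iff_continuousAt.2 fun x₀ => tendsto_iff_dist_tendsto_zero.2 ?_
  have h1 := tendsto_iff_dist_tendsto_zero.1 (hF.tendsto x₀)
  have h2 := tendsto_iff_dist_tendsto_zero.1 ((hT (F x₀)).tendsto x₀)
  refine squeeze_zero (fun _ => dist_nonneg) (fun x => ?_) (by simpa using h1.add h2)
  refine (dist_triangle _ (T x (F x₀)) _).trans (le_of_eq ?_)
  rw [(hc x).dist_eq]

theorem continuous_of_denseRange_of_isometry [TopologicalSpace X] {T : X → B → B}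
    (hc : ∀ x, Isometry (T x)) {E : Type*} {ι : E → B} (hι : DenseRange ι)
    (hT : ∀ f, Continuous (fun x => T x (ι f))) (b : B) : Continuous (fun x => T x b) := by
  obtain ⟨s, hs, hsb⟩ := mem_closure_iff_seq_limit.1 (hι b)
  choose f hf using hs
  have hu : TendstoUniformly (fun n x => T x (s n)) (fun x => T x b) Filter.atTop := by
    rw [Metric.tendstoUniformly_iff]
    intro ε hε
    filter_upwards [Metric.tendsto_nhds.1 hsb ε hε] with n hn x
    rwa [(hc x).dist_eq, dist_comm]
  exact hu.continuous (Filter.Frequently.of_forall fun n => hf n ▸ hT (f n))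

end Families

/-! ### Strict measurability and strict continuity of families of unitaries -/

section UnitaryFamilies

variable {A : Type w} [NonUnitalCStarAlgebra A] {X : Type*}

theorem UMult.isometry_lmul (u : UMult A) : Isometry (Mult.lmul (u : Mult A)) :=
  AddMonoidHomClass.isometry_of_norm (u : Mult A).fst (UMult.norm_lmul u)

theorem UMult.isometry_rmul (u : UMult A) : Isometry (fun a => Mult.rmul a (u : Mult A)) :=
  AddMonoidHomClass.isometry_of_norm (u : Mult A).snd (UMult.norm_rmul u)

theorem UMult.lmul_inv_lmul (u : UMult A) (a : A) :
    Mult.lmul ((u⁻¹ : UMult A) : Mult A) (Mult.lmul (u : Mult A) a) = a := by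
  rw [← Mult.mul_lmul, UMult.coe_inv, UMult.star_coe_mul_coe]; rfl

theorem UMult.dist_lmul_inv (u : UMult A) (a b : A) :
    dist (Mult.lmul ((u⁻¹ : UMult A) : Mult A) a) b = dist a (Mult.lmul (u : Mult A) b) := by
  rw [← (UMult.isometry_lmul u⁻¹).dist_eq a, UMult.lmul_inv_lmul]

theorem UMult.rmul_eq (u : UMult A) (a : A) :
    Mult.rmul a (u : Mult A) = star (Mult.lmul ((u⁻¹ : UMult A) : Mult A) (star a)) := by
  rw [Mult.star_lmul, star_star, UMult.coe_inv, star_star]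

/-- For unitaries, measurability of left multiplication suffices. -/
theorem StrictlyMeasurable.of_lmul [SecondCountableTopology A] [MeasurableSpace X] {μ : Measure X}
    {m : X → UMult A} (h : ∀ a, AEStronglyMeasurable (fun x => Mult.lmul (m x : Mult A) a) μ) :
    StrictlyMeasurable μ m := by
  refine fun a => ⟨h a, ?_⟩
  simp_rw [UMult.rmul_eq]
  refine continuous_star.comp_aestronglyMeasurable (aestronglyMeasurable_of_dist fun c => ?_)
  simp_rw [UMult.dist_lmul_inv]
  exact (aestronglyMeasurable_const.dist (h c)).aemeasurable

/-- For unitaries, continuity of left multiplication suffices. -/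
theorem StrictlyContinuous.of_lmul [TopologicalSpace X] {m : X → UMult A}
    (h : ∀ a, Continuous (fun x => Mult.lmul (m x : Mult A) a)) : StrictlyContinuous m := by
  refine fun a => ⟨h a, ?_⟩
  simp_rw [UMult.rmul_eq]
  refine continuous_star.comp (continuous_iff_continuousAt.2 fun x₀ => ?_)
  refine tendsto_iff_dist_tendsto_zero.2 ?_
  simp_rw [UMult.dist_lmul_inv]
  have := tendsto_iff_dist_tendsto_zero.1
    ((h (Mult.lmul (((m x₀)⁻¹ : UMult A) : Mult A) (star a))).tendsto x₀)
  have e : Mult.lmul (m x₀ : Mult A) (Mult.lmul (((m x₀)⁻¹ : UMult A) : Mult A) (star a)) =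
      star a := by
    rw [← Mult.mul_lmul, UMult.coe_inv, UMult.coe_mul_star_coe]; rfl
  rw [e] at this
  simpa only [dist_comm] using this

namespace StrictlyMeasurable

variable [MeasurableSpace X] {μ : Measure X} {m n : X → UMult A}

theorem lmul (h : StrictlyMeasurable μ m) {F : X → A} (hF : AEStronglyMeasurable F μ) :
    AEStronglyMeasurable (fun x => Mult.lmul (m x : Mult A) (F x)) μ :=
  aestronglyMeasurable_apply (T := fun x => Mult.lmul (m x : Mult A))
    (fun _ => (UMult.isometry_lmul _).continuous) (fun a => (h a).1) hF

theorem rmul (h : StrictlyMeasurable μ m) {F : X → A} (hF : AEStronglyMeasurable F μ) :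
    AEStronglyMeasurable (fun x => Mult.rmul (F x) (m x : Mult A)) μ :=
  aestronglyMeasurable_apply (T := fun x a => Mult.rmul a (m x : Mult A))
    (fun _ => (UMult.isometry_rmul _).continuous) (fun a => (h a).2) hF

theorem inv (h : StrictlyMeasurable μ m) : StrictlyMeasurable μ fun x => (m x)⁻¹ := by
  refine fun a => ⟨?_, ?_⟩
  · have := continuous_star.comp_aestronglyMeasurable (h (star a)).2
    refine this.congr (Filter.Eventually.of_forall fun x => ?_)
    simp [UMult.coe_inv, Mult.star_rmul]
  · have := continuous_star.comp_aestronglyMeasurable (h (star a)).1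
    refine this.congr (Filter.Eventually.of_forall fun x => ?_)
    simp [UMult.coe_inv, Mult.star_lmul]

theorem mul (hm : StrictlyMeasurable μ m) (hn : StrictlyMeasurable μ n) :
    StrictlyMeasurable μ fun x => m x * n x :=
  fun a => ⟨hm.lmul (hn a).1, hn.rmul (hm a).2⟩

theorem const (m : UMult A) : StrictlyMeasurable μ fun _ => m :=
  fun _ => ⟨aestronglyMeasurable_const, aestronglyMeasurable_const⟩

theorem comp {Y : Type*} [MeasurableSpace Y] {ν : Measure Y} (h : StrictlyMeasurable μ m)
    {τ : Y → X} (hτ : Measure.QuasiMeasurePreserving τ ν μ) :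
    StrictlyMeasurable ν fun y => m (τ y) :=
  fun a => ⟨(h a).1.comp_quasiMeasurePreserving hτ, (h a).2.comp_quasiMeasurePreserving hτ⟩

/-- Almost every section of a strictly measurable map is strictly measurable; separability is used
to choose one null set for all elements of `A`. -/
theorem ae_section [SecondCountableTopology A] {Y : Type*} [MeasurableSpace Y] {ν : Measure Y}
    [SFinite ν] [SFinite μ] {m : X × Y → UMult A} (h : StrictlyMeasurable (μ.prod ν) m) :
    ∀ᵐ x ∂μ, StrictlyMeasurable ν fun y => m (x, y) := by
  rcases isEmpty_or_nonempty A with hA | hA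
  · exact Filter.Eventually.of_forall fun x a => (hA.false a).elim
  have : ∀ᵐ x ∂μ, ∀ n, AEStronglyMeasurable
      (fun y => Mult.lmul (m (x, y) : Mult A) (TopologicalSpace.denseSeq A n)) ν :=
    ae_all_iff.2 fun n => (h (TopologicalSpace.denseSeq A n)).1.prodMk_left
  filter_upwards [this] with x hx
  exact .of_lmul (aestronglyMeasurable_of_denseRange
    (T := fun y => Mult.lmul (m (x, y) : Mult A)) (fun y => (UMult.isometry_lmul _).continuous)
    (TopologicalSpace.denseRange_denseSeq A) hx)

end StrictlyMeasurable

theorem StrictlyContinuous.rmul [TopologicalSpace X] {m : X → UMult A} (h : StrictlyContinuous m)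
    {F : X → A} (hF : Continuous F) : Continuous fun x => Mult.rmul (F x) (m x : Mult A) :=
  continuous_apply_of_isometry (T := fun x a => Mult.rmul a (m x : Mult A))
    (fun _ => UMult.isometry_rmul _) (fun a => (h a).2) hF

theorem StrictlyContinuous.inv [TopologicalSpace X] {m : X → UMult A} (h : StrictlyContinuous m) :
    StrictlyContinuous fun x => (m x)⁻¹ := by
  refine fun a => ⟨?_, ?_⟩
  · have := continuous_star.comp (h (star a)).2
    refine this.congr fun x => ?_
    simp [UMult.coe_inv, Mult.star_rmul]
  · have := continuous_star.comp (h (star a)).1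
    refine this.congr fun x => ?_
    simp [UMult.coe_inv, Mult.star_lmul]

theorem StrictlyContinuous.comp {Y : Type*} [TopologicalSpace X] [TopologicalSpace Y]
    {m : X → UMult A} (h : StrictlyContinuous m) {τ : Y → X} (hτ : Continuous τ) :
    StrictlyContinuous fun y => m (τ y) :=
  fun a => ⟨(h a).1.comp hτ, (h a).2.comp hτ⟩

theorem StrictlyContinuous.strictlyMeasurable [TopologicalSpace X] [SecondCountableTopology X]
    [MeasurableSpace X] [OpensMeasurableSpace X] {m : X → UMult A} (h : StrictlyContinuous m)
    (μ : Measure X) : StrictlyMeasurable μ m :=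
  fun a => ⟨(h a).1.aestronglyMeasurable, (h a).2.aestronglyMeasurable⟩

theorem StarAlgEquiv.dist_symm (φ : A ≃⋆ₐ[ℂ] A) (a b : A) :
    dist (φ.symm a) b = dist a (φ b) := by
  rw [← (StarAlgEquiv.isometry φ).dist_eq, StarAlgEquiv.apply_symm_apply]

theorem aestronglyMeasurable_symm [SecondCountableTopology A] [MeasurableSpace X] {μ : Measure X}
    {φ : X → A ≃⋆ₐ[ℂ] A} (h : ∀ a, AEStronglyMeasurable (fun x => φ x a) μ) (a : A) :
    AEStronglyMeasurable (fun x => (φ x).symm a) μ := by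
  refine aestronglyMeasurable_of_dist fun c => ?_
  simp_rw [StarAlgEquiv.dist_symm]
  exact (aestronglyMeasurable_const.dist (h c)).aemeasurable

theorem aestronglyMeasurable_aut [MeasurableSpace X] {μ : Measure X}
    {φ : X → A ≃⋆ₐ[ℂ] A} (h : ∀ a, AEStronglyMeasurable (fun x => φ x a) μ) {F : X → A}
    (hF : AEStronglyMeasurable F μ) : AEStronglyMeasurable (fun x => φ x (F x)) μ :=
  aestronglyMeasurable_apply (T := fun x a => φ x a)
    (fun x => (StarAlgEquiv.isometry (φ x)).continuous) h hF

theorem StrictlyMeasurable.map_aut [SecondCountableTopology A] [MeasurableSpace X] {μ : Measure X}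
    {φ : X → A ≃⋆ₐ[ℂ] A} (h : ∀ a, AEStronglyMeasurable (fun x => φ x a) μ) {m : X → UMult A}
    (hm : StrictlyMeasurable μ m) : StrictlyMeasurable μ fun x => UMult.map (φ x) (m x) :=
  .of_lmul fun a => aestronglyMeasurable_aut h (hm.lmul (aestronglyMeasurable_symm h a))

end UnitaryFamilies

/-! ### Translations, inversion and the modular function -/

section Haar

variable {G : Type u} [Group G] [TopologicalSpace G] [IsTopologicalGroup G] [LocallyCompactSpace G]

theorem modularFunction_pos (x : G) : 0 < modularFunction x := by
  have : 0 < Measure.modularCharacter x := Measure.modularCharacterFun_pos x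
  simpa [modularFunction] using this

theorem modularFunction_mul (x y : G) :
    modularFunction (x * y) = modularFunction x * modularFunction y := by
  simp [modularFunction, mul_comm]

theorem modularFunction_one : modularFunction (1 : G) = 1 := by
  simp [modularFunction]

variable [MeasurableSpace G] [BorelSpace G] [SecondCountableTopology G]
  (μ : Measure G) [μ.IsHaarMeasure]

theorem map_mul_right_inv_eq (z : G) :
    μ.map (· * z⁻¹) = (Measure.modularCharacter z)⁻¹ • μ := by
  rw [Measure.map_right_mul_eq_modularCharacterFun_smul μ z⁻¹]
  congr 1
  change Measure.modularCharacter z⁻¹ = _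
  refine eq_inv_of_mul_eq_one_left ?_
  rw [← map_mul]
  simp

variable {E : Type*} [NormedAddCommGroup E]

variable {μ} in
theorem MeasureTheory.Integrable.comp_mul_right_inv {f : G → E} (hf : Integrable f μ) (z : G) :
    Integrable (fun y => f (y * z⁻¹)) μ := by
  refine Integrable.comp_measurable (g := f) (f := (· * z⁻¹)) ?_ (measurable_mul_const _)
  rw [map_mul_right_inv_eq μ z]
  exact hf.smul_measure_nnreal

variable [NormedSpace ℝ E]

theorem integral_mul_right_inv (f : G → E) (z : G) :
    ∫ y, f (y * z⁻¹) ∂μ = modularFunction z • ∫ y, f y ∂μ := by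
  have h := (Homeomorph.mulRight z⁻¹).measurableEmbedding.integral_map (μ := μ) f
  have h2 := map_mul_right_inv_eq μ z
  simp only [Homeomorph.coe_mulRight] at h
  rw [← h, h2, integral_smul_nnreal_measure]
  rfl

theorem measurable_modularFunction : Measurable (modularFunction : G → ℝ) := by
  obtain ⟨K, hK, hK1⟩ := exists_compact_mem_nhds (1 : G)
  set s := closure K
  have hs : MeasurableSet s := isClosed_closure.measurableSet
  have h0 : (Measure.haar : Measure G) s ≠ 0 :=
    (Measure.measure_pos_of_mem_nhds _ (Filter.mem_of_superset hK1 subset_closure)).ne'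
  have h1 : (Measure.haar : Measure G) s ≠ ∞ := hK.closure.measure_ne_top
  have key : ∀ x : G, modularFunction x =
      ((Measure.haar : Measure G) ((· * x⁻¹) ⁻¹' s)).toReal /
        ((Measure.haar : Measure G) s).toReal := fun x => by
    have h := measure_image_mul_right (Measure.haar : Measure G) s x
    have h3 : (fun y => y * x) '' s = (· * x⁻¹) ⁻¹' s := by
      rw [Set.image_mul_right]
    rw [h3] at h
    rw [h, ENNReal.toReal_mul, ENNReal.toReal_ofReal (modularFunction_pos x).le,
      mul_div_cancel_right₀]
    exact ENNReal.toReal_ne_zero.2 ⟨h0, h1⟩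
  rw [funext key]
  exact (((measurable_measure_mul_right _ hs).comp measurable_inv).ennreal_toReal).div_const _

variable {μ} in
/-- Inversion of a left Haar measure has density `Δ⁻¹`, in the form of integrability; this is the
case of equal measures in `measure_lintegral_div_measure`. -/
theorem MeasureTheory.Integrable.modularFunction_inv_smul_comp_inv {f : G → E}
    (hf : Integrable f μ) : Integrable (fun x => (modularFunction x)⁻¹ • f x⁻¹) μ := by
  have hm : AEStronglyMeasurable (fun x => f x⁻¹) μ :=
    hf.1.comp_quasiMeasurePreserving (quasiMeasurePreserving_inv μ)
  refine ⟨measurable_modularFunction.inv.aestronglyMeasurable.smul hm, ?_⟩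
  obtain ⟨K, hK, hK1⟩ := exists_compact_mem_nhds (1 : G)
  set s := closure K
  have hs : MeasurableSet s := isClosed_closure.measurableSet
  have h0 : μ s ≠ 0 :=
    (Measure.measure_pos_of_mem_nhds _ (Filter.mem_of_superset hK1 subset_closure)).ne'
  have h1 : μ s ≠ ∞ := hK.closure.measure_ne_top
  obtain ⟨g, hg, hfg⟩ := hf.1.enorm
  have key := measure_lintegral_div_measure μ μ hs h0 h1 g hg
  have e : ∀ x : G, μ ((· * x⁻¹) ⁻¹' s) = ENNReal.ofReal (modularFunction x) * μ s := fun x => by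
    rw [← measure_image_mul_right μ s x, Set.image_mul_right]
  have hfin : ∫⁻ x, g x ∂μ ≠ ∞ := by
    rw [← lintegral_congr_ae hfg]
    exact hf.2.ne
  rw [← key] at hfin
  have h2 : ∫⁻ y, g y⁻¹ / μ ((· * y⁻¹) ⁻¹' s) ∂μ < ∞ := by
    by_contra hcon
    rw [not_lt, top_le_iff] at hcon
    rw [hcon, ENNReal.mul_top h0] at hfin
    exact hfin rfl
  have h3 : ∫⁻ y, ‖(modularFunction y)⁻¹ • f y⁻¹‖ₑ ∂μ =
      μ s * ∫⁻ y, g y⁻¹ / μ ((· * y⁻¹) ⁻¹' s) ∂μ := by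
    rw [← lintegral_const_mul' _ _ h1]
    refine lintegral_congr_ae ?_
    filter_upwards [(quasiMeasurePreserving_inv μ).ae hfg] with y hy
    rw [e, enorm_smul, ← hy, enorm_inv (modularFunction_pos y).ne',
      Real.enorm_of_nonneg (modularFunction_pos y).le, div_eq_mul_inv,
      ENNReal.mul_inv (Or.inr h1) (Or.inr h0), mul_comm (ENNReal.ofReal _)⁻¹ (μ s)⁻¹,
      mul_comm (μ s), mul_assoc, mul_comm _ (μ s), ← mul_assoc (μ s), ENNReal.mul_inv_cancel h0 h1,
      one_mul, mul_comm]
  rw [HasFiniteIntegral, h3]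
  exact ENNReal.mul_lt_top h1.lt_top h2

end Haar

section L1

variable {G : Type u} [MeasurableSpace G] {μ : Measure G} {A : Type w} [NormedAddCommGroup A]
  [NormedSpace ℂ A]

/-- A weighted composition operator on functions that preserves integrability induces a linear map
of `L¹`. -/
theorem MeasureTheory.L1.exists_linearMap {τ : G → G} (hτ : Measure.QuasiMeasurePreserving τ μ μ)
    (V : G → A →L[ℂ] A)
    (h : ∀ f, Integrable f μ → Integrable (fun x => V x (f (τ x))) μ) :
    ∃ L : (G →₁[μ] A) →ₗ[ℂ] (G →₁[μ] A), ∀ f, L f =ᵐ[μ] fun x => V x (f (τ x)) := by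
  refine ⟨{ toFun := fun f => (h f (L1.integrable_coeFn f)).toL1 _
            map_add' := fun f g => ?_
            map_smul' := fun c f => ?_ },
    fun f => Integrable.coeFn_toL1 (h f (L1.integrable_coeFn f))⟩
  · rw [← Integrable.toL1_add]
    rw [Integrable.toL1_eq_toL1_iff]
    filter_upwards [hτ.ae (Lp.coeFn_add f g)] with x hx
    exact (congrArg (V x) hx).trans (map_add (V x) _ _)
  · rw [RingHom.id_apply, ← Integrable.toL1_smul]
    rw [Integrable.toL1_eq_toL1_iff]
    filter_upwards [hτ.ae (Lp.coeFn_smul c f)] with x hx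
    exact (congrArg (V x) hx).trans (map_smul (V x) c _)

end L1

section L1Parameter

variable {G : Type u} [MeasurableSpace G] {μ : Measure G} {A : Type w} [NormedAddCommGroup A]
  {X : Type*}

/-! ### Functions of a parameter with values in `L¹` -/

/-- Dominated convergence in `L¹`, with a parameter. -/
theorem MeasureTheory.L1.continuousAt_of_dominated [TopologicalSpace X] [FirstCountableTopology X]
    {Φ : X → G →₁[μ] A} {F : X → G → A} (hΦ : ∀ p, Φ p =ᵐ[μ] F p) {x₀ : X} {g : G → ℝ}
    (hg : Integrable g μ) (hb : ∀ᶠ p in 𝓝 x₀, ∀ᵐ y ∂μ, ‖F p y‖ ≤ g y)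
    (hF : ∀ᵐ y ∂μ, ContinuousAt (fun p => F p y) x₀) : ContinuousAt Φ x₀ := by
  refine tendsto_iff_dist_tendsto_zero.2 ?_
  have e : ∀ p, dist (Φ p) (Φ x₀) = ∫ y, ‖F p y - F x₀ y‖ ∂μ := fun p => by
    rw [dist_eq_norm, L1.norm_eq_integral_norm]
    refine integral_congr_ae ?_
    filter_upwards [Lp.coeFn_sub (Φ p) (Φ x₀), hΦ p, hΦ x₀] with y h1 h2 h3
    rw [h1, Pi.sub_apply, h2, h3]
  simp_rw [e]
  have hm : ∀ p, AEStronglyMeasurable (F p) μ := fun p =>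
    (Lp.aestronglyMeasurable (Φ p)).congr (hΦ p)
  have := tendsto_integral_filter_of_dominated_convergence (μ := μ) (l := 𝓝 x₀)
    (F := fun p y => ‖F p y - F x₀ y‖) (f := fun _ => (0 : ℝ)) (fun y => g y + g y)
    (Filter.Eventually.of_forall fun p => ((hm p).sub (hm x₀)).norm) ?_ (hg.add hg) ?_
  · simpa using this
  · filter_upwards [hb] with p hp
    filter_upwards [hp, hb.self_of_nhds] with y h1 h2
    rw [norm_norm]
    exact (norm_sub_le _ _).trans (add_le_add h1 h2)
  · filter_upwards [hF] with y hy
    have := (hy.sub (continuousAt_const (y := F x₀ y))).norm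
    simpa [ContinuousAt] using this

/-- By Fubini's theorem, a jointly measurable function defines a measurable map into `L¹`. -/
theorem MeasureTheory.L1.aestronglyMeasurable_of_prod [MeasurableSpace X] {ρ : Measure X}
    [SFinite ρ] [SFinite μ] [SecondCountableTopology (G →₁[μ] A)]
    {Φ : X → G →₁[μ] A} {F : X → G → A} (hΦ : ∀ p, Φ p =ᵐ[μ] F p)
    (hF : AEStronglyMeasurable (fun p : X × G => F p.1 p.2) (ρ.prod μ)) :
    AEStronglyMeasurable Φ ρ := by
  refine aestronglyMeasurable_of_dist fun c => ?_
  have e : ∀ p, dist (Φ p) c = ∫ y, ‖F p y - c y‖ ∂μ := fun p => by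
    rw [dist_eq_norm, L1.norm_eq_integral_norm]
    refine integral_congr_ae ?_
    filter_upwards [Lp.coeFn_sub (Φ p) c, hΦ p] with y h1 h2
    rw [h1, Pi.sub_apply, h2]
  simp_rw [e]
  refine AEStronglyMeasurable.aemeasurable ?_
  refine AEStronglyMeasurable.integral_prod_right' (f := fun p : X × G => ‖F p.1 p.2 - c p.2‖) ?_
  exact (hF.sub (Lp.aestronglyMeasurable c).comp_snd).norm

end L1Parameter

/-- `L¹(G; A)` is separable when `G` is second countable and `A` is separable. -/
theorem MeasureTheory.L1.secondCountableTopology {G : Type u} [MeasurableSpace G]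
    [MeasurableSpace.CountablyGenerated G] {μ : Measure G} [SFinite μ] {A : Type w}
    [NormedAddCommGroup A] [SecondCountableTopology A] : SecondCountableTopology (G →₁[μ] A) := by
  have : Fact ((1 : ℝ≥0∞) ≠ ∞) := ⟨ENNReal.one_ne_top⟩
  infer_instance

/-! ### Pointwise identities for twisted actions -/

namespace Mult

variable {A : Type w} [NonUnitalCStarAlgebra A]

theorem of_apply_lmul (φ : A ≃⋆ₐ[ℂ] A) (m : Mult A) (a : A) :
    of (φ (lmul m a)) = map φ m * of (φ a) := by
  rw [← map_of, of_lmul, map_mul, map_of]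

theorem of_apply_rmul (φ : A ≃⋆ₐ[ℂ] A) (a : A) (m : Mult A) :
    of (φ (rmul a m)) = of (φ a) * map φ m := by
  rw [← map_of, of_rmul, map_mul, map_of]

theorem lmul_smul (m : Mult A) (c : ℝ) (a : A) : lmul m (c • a) = c • lmul m a :=
  of_injective <| by rw [of_lmul, of_smul, of_smul, of_lmul, mul_smul_comm]

theorem rmul_smul (m : Mult A) (c : ℝ) (a : A) : rmul (c • a) m = c • rmul a m :=
  of_injective <| by rw [of_rmul, of_smul, of_smul, of_rmul, smul_mul_assoc]

end Mult

theorem StarAlgEquiv.apply_real_smul {A : Type w} [NonUnitalCStarAlgebra A] (φ : A ≃⋆ₐ[ℂ] A)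
    (c : ℝ) (a : A) : φ (c • a) = c • φ a := by
  rw [← Complex.coe_smul, ← Complex.coe_smul, map_smul]

theorem UMult.star_map_mul_map {A : Type w} [NonUnitalCStarAlgebra A] (φ : A ≃⋆ₐ[ℂ] A)
    (u : UMult A) (m : Mult A) : star (Mult.map φ u) * (Mult.map φ u * m) = m :=
  UMult.star_coe_mul_coe_mul (UMult.map φ u) m

namespace TwistedAction

section Pointwise

variable {G : Type u} {A : Type w} [Group G] [NonUnitalCStarAlgebra A] (T : TwistedAction G A)

theorem of_act_act (x y : G) (b : A) : Mult.of (T.act x (T.act y b)) =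
    (T.coc x y : Mult A) * (Mult.of (T.act (x * y) b) * star (T.coc x y : Mult A)) := by
  rw [T.act_act, UMult.of_ad, mul_assoc]

theorem map_act_map_act (x y : G) (m : Mult A) :
    Mult.map (T.act x) (Mult.map (T.act y) m) =
      (T.coc x y : Mult A) * Mult.map (T.act (x * y)) m * star (T.coc x y : Mult A) := by
  -- Both sides agree after multiplying on the right by `a_x(a_y(b))`.
  refine Mult.ext_lmul fun b => Mult.of_injective ?_
  obtain ⟨c, rfl⟩ : ∃ c, b = T.act x (T.act y c) :=
    ⟨(T.act y).symm ((T.act x).symm b), by simp⟩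
  rw [Mult.of_lmul, Mult.of_lmul, ← Mult.of_apply_lmul, Mult.lmul_map,
    StarAlgEquiv.symm_apply_apply, of_act_act, of_act_act, Mult.of_apply_lmul]
  simp [mul_assoc]

theorem map_coc_mul_coc (x y z : G) :
    Mult.map (T.act x) (T.coc y z : Mult A) * (T.coc x (y * z) : Mult A) =
      (T.coc x y : Mult A) * (T.coc (x * y) z : Mult A) := (T.cocycle x y z).symm

theorem cocycle_units (x y z : G) : T.coc x y * T.coc (x * y) z =
    UMult.map (T.act x) (T.coc y z) * T.coc x (y * z) := Subtype.ext (T.cocycle x y z)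

theorem map_coc_inv_mul (x z : G) :
    Mult.map (T.act x) (T.coc z (z⁻¹ * x⁻¹) : Mult A) * (T.coc x x⁻¹ : Mult A) =
      (T.coc x z : Mult A) * (T.coc (x * z) (z⁻¹ * x⁻¹) : Mult A) := by
  have := T.map_coc_mul_coc x z (z⁻¹ * x⁻¹)
  rwa [mul_inv_cancel_left] at this

/-- The pointwise form of `(f ⋄ (δ_z ⊗ m)) ⋄ g = f ⋄ ((δ_z ⊗ m) ⋄ g)`. -/
theorem convolution_integrand_assoc (u z w : G) (m : Mult A) (c : ℝ) (a b : A) :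
    Mult.rmul ((c • Mult.rmul (Mult.rmul a (Mult.map (T.act u) m)) (T.coc u z : Mult A)) *
        T.act (u * z) b) (T.coc (u * z) w : Mult A) =
      c • Mult.rmul (a * T.act u (Mult.rmul (Mult.lmul m (T.act z b)) (T.coc z w : Mult A)))
        (T.coc u (z * w) : Mult A) := by
  refine Mult.of_injective ?_
  simp only [Mult.of_rmul, Mult.of_mul, Mult.of_smul, Mult.of_apply_rmul, Mult.of_apply_lmul,
    of_act_act, smul_mul_assoc, mul_assoc, map_coc_mul_coc, UMult.star_coe_mul_coe_mul]

/-- The pointwise form of `(f⋆ ⋄ (δ_z ⊗ m)⋆) ⋄ (δ_z ⊗ m) = f⋆` for unitary `m`. -/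
theorem dirac_unitary_right (y z : G) (m : UMult A) (b : A) :
    Mult.rmul (Mult.rmul (Mult.lmul (star (T.coc y y⁻¹ : Mult A))
      (T.act y (star (Mult.rmul (Mult.lmul (m : Mult A) (T.act z b))
        (T.coc z (z⁻¹ * y⁻¹) : Mult A))))) (Mult.map (T.act y) m)) (T.coc y z : Mult A) =
      Mult.lmul (star (T.coc (y * z) (z⁻¹ * y⁻¹) : Mult A)) (T.act (y * z) (star b)) := by
  refine Mult.of_injective ?_
  have h := congrArg star (T.map_coc_inv_mul y z)
  rw [star_mul, star_mul] at h
  rw [Mult.star_rmul, Mult.star_lmul, ← StarHomClass.map_star (T.act z)]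
  simp only [Mult.of_rmul, Mult.of_lmul, Mult.of_apply_rmul, Mult.of_apply_lmul,
    of_act_act, Mult.map_star, mul_assoc, UMult.star_map_mul_map, UMult.star_coe_mul_coe, mul_one]
  rw [← mul_assoc, h, mul_assoc, UMult.star_coe_mul_coe_mul]

/-- The pointwise form of `(δ_z ⊗ m) ⋄ ((δ_z ⊗ m)⋆ ⋄ g⋆) = g⋆` for unitary `m`. -/
theorem dirac_unitary_left (z v : G) (m : UMult A) (b : A) :
    Mult.rmul (Mult.lmul (m : Mult A) (T.act z (Mult.lmul (star (T.coc v v⁻¹ : Mult A))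
      (T.act v (star (Mult.rmul (Mult.rmul b (Mult.map (T.act (v⁻¹ * z⁻¹)) m))
        (T.coc (v⁻¹ * z⁻¹) z : Mult A))))))) (T.coc z v : Mult A) =
      Mult.lmul (star (T.coc (z * v) (v⁻¹ * z⁻¹) : Mult A)) (T.act (z * v) (star b)) := by
  refine Mult.of_injective ?_
  have h1 := T.map_coc_mul_coc z v v⁻¹
  rw [mul_inv_cancel, T.coc_one_right, OneMemClass.coe_one, mul_one] at h1
  have h2 := T.map_coc_mul_coc (z * v) (v⁻¹ * z⁻¹) z
  have e : z * v * (v⁻¹ * z⁻¹) = 1 := by group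
  rw [e, T.coc_one_left, OneMemClass.coe_one, mul_one, inv_mul_cancel_right] at h2
  have h3 := T.map_act_map_act (z * v) (v⁻¹ * z⁻¹) (star (m : Mult A))
  rw [e, Mult.map_of_id T.act_one] at h3
  have h4 : star (Mult.map (T.act z) (T.coc v v⁻¹ : Mult A)) * (T.coc z v : Mult A) =
      star (T.coc (z * v) v⁻¹ : Mult A) := by
    rw [h1, star_mul, mul_assoc, UMult.star_coe_mul_coe, mul_one]
  have h5 : star (T.coc (z * v) v⁻¹ : Mult A) *
      star (Mult.map (T.act (z * v)) (T.coc (v⁻¹ * z⁻¹) z : Mult A)) =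
      star (T.coc (z * v) (v⁻¹ * z⁻¹) : Mult A) := by rw [← star_mul, h2]
  rw [Mult.star_rmul, Mult.star_rmul]
  simp only [Mult.of_rmul, Mult.of_lmul, Mult.of_apply_lmul, of_act_act, Mult.map_star, mul_assoc,
    UMult.star_coe_mul_coe, mul_one]
  rw [← mul_assoc (star (Mult.map (T.act z) _)), h4,
    ← mul_assoc (star (T.coc (z * v) v⁻¹ : Mult A)), h5, ← Mult.map_star, ← Mult.map_star, h3]
  simp only [mul_assoc, UMult.star_coe_mul_coe_mul, UMult.coe_mul_star_coe_mul]

/-- The pointwise form of `(δ_z ⊗ m) ⋄ (δ_w ⊗ n) = δ_{zw} ⊗ m a_z(n) α(z, w)`. -/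
theorem dirac_mul (z w v : G) (m n : Mult A) (b : A) :
    Mult.rmul (Mult.lmul m (T.act z (Mult.rmul (Mult.lmul n (T.act w b)) (T.coc w v : Mult A))))
      (T.coc z (w * v) : Mult A) =
    Mult.rmul (Mult.lmul (m * Mult.map (T.act z) n * (T.coc z w : Mult A)) (T.act (z * w) b))
      (T.coc (z * w) v : Mult A) := by
  refine Mult.of_injective ?_
  simp only [Mult.of_rmul, Mult.of_lmul, Mult.of_apply_rmul, Mult.of_apply_lmul,
    of_act_act, mul_assoc, map_coc_mul_coc, UMult.star_coe_mul_coe_mul]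

end Pointwise

/-! ### Measurability of the cocycle on slices -/

section Slices

variable {G : Type u} {A : Type w} [Group G] [MeasurableSpace G] [MeasurableMul₂ G]
  [NonUnitalCStarAlgebra A] [SecondCountableTopology A]
  {T : TwistedAction G A} {μ : Measure G} [SFinite μ] [μ.IsMulLeftInvariant]

/-- Joint measurability gives measurability of `α(x, ·)` for almost every `x` only; the cocycle
identity `α(x, yz) = a_x[α(y, z)]⋆ α(x, y) α(xy, z)`, used with a generic `y`, gives it for every
`x`. -/
theorem IsMeasurable.coc_left [NeZero μ] (hT : T.IsMeasurable μ) (x : G) :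
    StrictlyMeasurable μ (T.coc x) := by
  have h1 := hT.2.ae_section
  have h2 := ((measurePreserving_mul_left μ x).quasiMeasurePreserving).ae h1
  obtain ⟨y, hy1, hy2⟩ := (h1.and h2).exists
  have h3 : StrictlyMeasurable μ fun z => T.coc x (y * z) := by
    have e : (fun z => T.coc x (y * z)) =
        fun z => (UMult.map (T.act x) (T.coc y z))⁻¹ * (T.coc x y * T.coc (x * y) z) := by
      funext z
      rw [T.cocycle_units, inv_mul_cancel_left]
    rw [e]
    exact (StrictlyMeasurable.map_aut (φ := fun _ => T.act x)
      (fun _ => aestronglyMeasurable_const) hy1).inv.mul ((StrictlyMeasurable.const _).mul hy2)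
  have := h3.comp (measurePreserving_mul_left μ y⁻¹).quasiMeasurePreserving
  simpa using this

variable [MeasurableInv G]

theorem IsMeasurable.coc_right [NeZero μ] (hT : T.IsMeasurable μ) (z : G) :
    StrictlyMeasurable μ fun x => T.coc x z := by
  have h1 : ∀ᵐ y ∂μ, StrictlyMeasurable μ fun x => T.coc x y :=
    (hT.2.comp Measure.measurePreserving_swap.quasiMeasurePreserving).ae_section
  have h2 := (quasiMeasurePreserving_mul_right μ z).ae h1
  obtain ⟨y, hy1, hy2⟩ := (h1.and h2).exists
  have h3 : StrictlyMeasurable μ fun x => T.coc (x * y) z := by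
    have e : (fun x => T.coc (x * y) z) =
        fun x => (T.coc x y)⁻¹ * (UMult.map (T.act x) (T.coc y z) * T.coc x (y * z)) := by
      funext x
      rw [← T.cocycle_units, inv_mul_cancel_left]
    rw [e]
    exact hy1.inv.mul ((StrictlyMeasurable.map_aut hT.1 (StrictlyMeasurable.const _)).mul hy2)
  have := h3.comp (quasiMeasurePreserving_mul_right μ y⁻¹)
  simpa using this

/-- The curve `(x, x⁻¹)` may be a null set, so this too needs the cocycle identity, applied to
`(x⁻¹, xw, w⁻¹)` with a generic `x`. -/
theorem IsMeasurable.coc_inv [NeZero μ] (hT : T.IsMeasurable μ) :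
    StrictlyMeasurable μ fun x => T.coc x x⁻¹ := by
  have h1 : ∀ᵐ y ∂μ, StrictlyMeasurable μ fun x => T.coc (y * x) x⁻¹ :=
    (hT.2.comp (((measurePreserving_mul_prod_inv μ μ).comp
      Measure.measurePreserving_swap).quasiMeasurePreserving)).ae_section
  obtain ⟨y, hy⟩ := h1.exists
  have e : (fun x => T.coc x x⁻¹) = fun x => (T.coc y⁻¹ (y * x))⁻¹ *
      (UMult.map (T.act y⁻¹) (T.coc (y * x) x⁻¹) * T.coc y⁻¹ y) := by
    funext x
    have := T.cocycle_units y⁻¹ (y * x) x⁻¹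
    rw [inv_mul_cancel_left, mul_inv_cancel_right] at this
    rw [← this, inv_mul_cancel_left]
  rw [e]
  exact ((hT.coc_left y⁻¹).comp
    (measurePreserving_mul_left μ y).quasiMeasurePreserving).inv.mul
    ((StrictlyMeasurable.map_aut (φ := fun _ => T.act y⁻¹)
      (fun _ => aestronglyMeasurable_const) hy).mul (StrictlyMeasurable.const _))

end Slices

end TwistedAction

namespace TwistedAction

/-! ### The operators of convolution by `δ_z ⊗ m` -/

section Operators

variable {G : Type u} {A : Type w} [Group G] [NonUnitalCStarAlgebra A] {T : TwistedAction G A}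

/-- The left convolution operator `f ↦ (δ_z ⊗ m) ⋄ f` on functions. -/
def diracLeft (T : TwistedAction G A) (z : G) (m : Mult A) (f : G → A) : G → A := fun x =>
  Mult.rmul (Mult.lmul m (T.act z (f (z⁻¹ * x)))) (T.coc z (z⁻¹ * x) : Mult A)

theorem diracLeft_one (m : Mult A) (f : G → A) (y : G) :
    T.diracLeft 1 m f y = Mult.lmul m (f y) := by
  refine Mult.of_injective ?_
  simp [diracLeft, T.coc_one_left, T.act_one, Mult.of_rmul]

variable [TopologicalSpace G] [IsTopologicalGroup G] [LocallyCompactSpace G]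

/-- The right convolution operator `f ↦ f ⋄ (δ_z ⊗ m)` on functions. -/
def diracRight (T : TwistedAction G A) (z : G) (m : Mult A) (f : G → A) : G → A := fun x =>
  (modularFunction z)⁻¹ • Mult.rmul
    (Mult.rmul (f (x * z⁻¹)) (Mult.map (T.act (x * z⁻¹)) m)) (T.coc (x * z⁻¹) z : Mult A)

theorem diracRight_invol_diracLeft (z : G) (m : UMult A) (f : G → A) :
    T.diracRight z m (T.invol (T.diracLeft z m f)) = T.invol f := by
  funext x
  obtain ⟨y, rfl⟩ : ∃ y, x = y * z := ⟨x * z⁻¹, by simp⟩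
  simp only [diracRight, invol, diracLeft, mul_inv_cancel_right]
  rw [Mult.rmul_smul, Mult.rmul_smul, T.dirac_unitary_right, smul_smul, modularFunction_mul,
    mul_inv_rev, mul_inv_rev]

theorem diracLeft_invol_diracRight (z : G) (m : UMult A) (f : G → A) :
    T.diracLeft z m (T.invol (T.diracRight z m f)) = T.invol f := by
  funext x
  obtain ⟨v, rfl⟩ : ∃ v, x = z * v := ⟨z⁻¹ * x, by simp⟩
  simp only [diracRight, invol, diracLeft, inv_mul_cancel_left]
  simp only [star_smul, star_trivial (modularFunction z)⁻¹, StarAlgEquiv.apply_real_smul,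
    Mult.lmul_smul, Mult.rmul_smul]
  rw [T.dirac_unitary_left, smul_smul, modularFunction_mul, mul_inv_rev, mul_inv_rev]

end Operators

/-! ### The image of `L¹(G; A)` in the crossed product -/

section Image

variable {G : Type u} {A : Type w} [Group G] [TopologicalSpace G] [IsTopologicalGroup G]
  [LocallyCompactSpace G] [MeasurableSpace G] [NonUnitalCStarAlgebra A] {T : TwistedAction G A}
  {μ : Measure G}

variable (T μ) in
/-- The canonical map `L¹(G; A) → A ⋊ G` as a linear map. -/
def ofL1Lin : (G →₁[μ] A) →ₗ[ℂ] T.CrossedProduct μ where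
  toFun := T.ofL1 μ
  map_add' f g := Subtype.ext <| Subtype.ext <| funext fun π => map_add π.map f g
  map_smul' c f := Subtype.ext <| Subtype.ext <| funext fun π => map_smul π.map c f

theorem norm_ofL1_le (f : G →₁[μ] A) : ‖T.ofL1 μ f‖ ≤ ‖f‖ := by
  change ‖T.universalRep μ f‖ ≤ ‖f‖
  exact lp.norm_le_of_forall_le (norm_nonneg _) fun π => π.norm_le f

theorem continuous_ofL1 : Continuous (T.ofL1 μ) :=
  AddMonoidHomClass.continuous_of_bound (T.ofL1Lin μ) 1 fun f => by
    rw [one_mul]; exact norm_ofL1_le f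

theorem ofL1_eq_mul {f g h : G →₁[μ] A} (H : h =ᵐ[μ] T.conv μ f g) :
    T.ofL1 μ h = T.ofL1 μ f * T.ofL1 μ g :=
  Subtype.ext <| Subtype.ext <| funext fun π => π.map_conv f g h H

theorem ofL1_eq_star {f h : G →₁[μ] A} (H : h =ᵐ[μ] T.invol f) :
    T.ofL1 μ h = star (T.ofL1 μ f) :=
  Subtype.ext <| Subtype.ext <| funext fun π => π.map_invol f h H

/-- If each representation is dominated by another one on the values of `g` at `f`, then
`‖g‖ ≤ ‖f‖` in the enveloping norm. -/
theorem norm_ofL1_le_of_forall {f g : G →₁[μ] A}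
    (h : ∀ π : T.L1Rep μ, ∃ π' : T.L1Rep μ, ‖π.map g‖ ≤ ‖π'.map f‖) :
    ‖T.ofL1 μ g‖ ≤ ‖T.ofL1 μ f‖ := by
  refine lp.norm_le_of_forall_le (norm_nonneg _) fun π => ?_
  obtain ⟨π', hπ⟩ := h π
  exact hπ.trans (lp.norm_apply_le_norm ENNReal.top_ne_zero (T.universalRep μ f) π')

theorem IsDiracTensor.lmul_eq {z : G} {m : Mult A} {M : Mult (T.CrossedProduct μ)}
    (hM : T.IsDiracTensor μ z m M) {f h : G →₁[μ] A} (H : h =ᵐ[μ] T.diracLeft z m f) :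
    Mult.lmul M (T.ofL1 μ f) = T.ofL1 μ h := by
  obtain ⟨h', hh', e⟩ := hM.left f
  rw [e]
  exact congrArg _ (Lp.ext (hh'.trans H.symm))

theorem IsDiracTensor.exists_left {z : G} {m : Mult A} {M : Mult (T.CrossedProduct μ)}
    (hM : T.IsDiracTensor μ z m M) (f : G →₁[μ] A) : ∃ h : G →₁[μ] A,
      h =ᵐ[μ] T.diracLeft z m f ∧ Mult.lmul M (T.ofL1 μ f) = T.ofL1 μ h := hM.left f

theorem IsDiracTensor.rmul_eq {m : Mult A} {M : Mult (T.CrossedProduct μ)}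
    (hM : T.IsDiracTensor μ 1 m M) {f h : G →₁[μ] A}
    (H : h =ᵐ[μ] fun y => Mult.rmul (f y) (Mult.map (T.act y) m)) :
    Mult.rmul (T.ofL1 μ f) M = T.ofL1 μ h := by
  obtain ⟨h', hh', e⟩ := hM.right f
  rw [e]
  refine congrArg _ (Lp.ext (hh'.trans (Filter.EventuallyEq.trans ?_ H.symm)))
  refine Filter.Eventually.of_forall fun y => Mult.of_injective ?_
  simp [T.coc_one_right, modularFunction_one, Mult.of_rmul]

end Image

section ConvolutionAlgebra

/-! ### The twisted convolution algebra `L¹(G; A)` -/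

variable {G : Type u} {A : Type w} [Group G] [TopologicalSpace G] [IsTopologicalGroup G]
  [MeasurableSpace G] [BorelSpace G]
  [NonUnitalCStarAlgebra A] {T : TwistedAction G A} {μ : Measure G} [μ.IsHaarMeasure]

theorem diracLeft_congr (z : G) (m : Mult A) {f g : G → A} (h : f =ᵐ[μ] g) :
    T.diracLeft z m f =ᵐ[μ] T.diracLeft z m g := by
  filter_upwards [(measurePreserving_mul_left μ z⁻¹).quasiMeasurePreserving.ae h] with x hx
  simp only [diracLeft, hx]

variable [LocallyCompactSpace G] [SecondCountableTopology G]

theorem diracRight_congr (z : G) (m : Mult A) {f g : G → A} (h : f =ᵐ[μ] g) :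
    T.diracRight z m f =ᵐ[μ] T.diracRight z m g := by
  filter_upwards [(quasiMeasurePreserving_mul_right μ z⁻¹).ae h] with x hx
  simp only [diracRight, hx]

theorem invol_congr {f g : G → A} (h : f =ᵐ[μ] g) : T.invol f =ᵐ[μ] T.invol g := by
  filter_upwards [(quasiMeasurePreserving_inv μ).ae h] with x hx
  simp only [invol, hx]

/-- The twisted convolution does not depend on representatives, at any point `x`. -/
theorem conv_congr {f f' g g' : G → A} (hf : f =ᵐ[μ] f') (hg : g =ᵐ[μ] g') :
    T.conv μ f g = T.conv μ f' g' := by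
  funext x
  refine integral_congr_ae ?_
  filter_upwards [hf, ((quasiMeasurePreserving_mul_right μ x).comp
    (quasiMeasurePreserving_inv μ)).ae hg] with y h1 h2
  simp only [Function.comp_apply] at h2
  simp only [h1, h2]

/-- `f ⋄ ((δ_z ⊗ m) ⋄ g) = (f ⋄ (δ_z ⊗ m)) ⋄ g`, by right translation of the integration variable;
this absorbs the factor `Δ(z)⁻¹`. -/
theorem conv_diracLeft (z : G) (m : Mult A) (f g : G → A) :
    T.conv μ f (T.diracLeft z m g) = T.conv μ (T.diracRight z m f) g := by
  funext x
  set K : G → A := fun u => Mult.rmul (f u * T.act u (T.diracLeft z m g (u⁻¹ * x)))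
    (T.coc u (u⁻¹ * x) : Mult A) with hK
  have e : ∀ y, Mult.rmul (T.diracRight z m f y * T.act y (g (y⁻¹ * x)))
      (T.coc y (y⁻¹ * x) : Mult A) = (modularFunction z)⁻¹ • K (y * z⁻¹) := fun y => by
    obtain ⟨u, rfl⟩ : ∃ u, y = u * z := ⟨y * z⁻¹, by simp⟩
    have h := T.convolution_integrand_assoc u z ((u * z)⁻¹ * x) m (modularFunction z)⁻¹ (f u)
      (g ((u * z)⁻¹ * x))
    have e1 : z * ((u * z)⁻¹ * x) = u⁻¹ * x := by group
    have e2 : z⁻¹ * (u⁻¹ * x) = (u * z)⁻¹ * x := by group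
    rw [e1] at h
    simp only [hK, diracRight, diracLeft, mul_inv_cancel_right, e2]
    exact h
  change ∫ u, K u ∂μ = _
  simp only [conv, e]
  rw [integral_smul, integral_mul_right_inv, inv_smul_smul₀ (modularFunction_pos z).ne']

theorem IsMeasurable.integrable_conv_integrand (hT : T.IsMeasurable μ) {f g : G → A}
    (hf : Integrable f μ) (hg : Integrable g μ) :
    Integrable (fun p : G × G => Mult.rmul (f p.2 * T.act p.2 (g (p.2⁻¹ * p.1)))
      (T.coc p.2 (p.2⁻¹ * p.1) : Mult A)) (μ.prod μ) := by
  have hK : Integrable (fun p : G × G => Mult.rmul (f p.1 * T.act p.1 (g p.2))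
      (T.coc p.1 p.2 : Mult A)) (μ.prod μ) := by
    refine (hf.norm.mul_prod hg.norm).mono' ?_ (Filter.Eventually.of_forall fun p => ?_)
    · refine hT.2.rmul (hf.1.comp_fst.mul ?_)
      exact aestronglyMeasurable_aut (φ := fun p : G × G => T.act p.1)
        (fun a => (hT.1 a).comp_fst) hg.1.comp_snd
    · rw [UMult.norm_rmul]
      refine (norm_mul_le _ _).trans ?_
      rw [StarAlgEquiv.norm_map]
  exact (measurePreserving_prod_inv_mul_swap μ μ).integrable_comp_of_integrable hK

theorem IsMeasurable.integrable_conv (hT : T.IsMeasurable μ) {f g : G → A} (hf : Integrable f μ)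
    (hg : Integrable g μ) : Integrable (T.conv μ f g) μ :=
  (hT.integrable_conv_integrand hf hg).integral_prod_left

theorem IsMeasurable.exists_conv (hT : T.IsMeasurable μ) (f g : G →₁[μ] A) :
    ∃ h : G →₁[μ] A, h =ᵐ[μ] T.conv μ f g :=
  ⟨_, Integrable.coeFn_toL1
    (hT.integrable_conv (L1.integrable_coeFn f) (L1.integrable_coeFn g))⟩

variable [SecondCountableTopology A]

theorem IsMeasurable.integrable_diracLeft (hT : T.IsMeasurable μ) (z : G) (m : UMult A)
    {f : G → A} (hf : Integrable f μ) : Integrable (T.diracLeft z m f) μ := by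
  have h1 : Integrable (fun x => f (z⁻¹ * x)) μ := hf.comp_mul_left z⁻¹
  refine h1.congr' ?_ (Filter.Eventually.of_forall fun x => ?_)
  · refine ((hT.coc_left z).comp (measurePreserving_mul_left μ z⁻¹).quasiMeasurePreserving).rmul ?_
    refine (StrictlyMeasurable.const m).lmul ?_
    exact (autCLM (T.act z)).continuous.comp_aestronglyMeasurable h1.1
  · rw [diracLeft, UMult.norm_rmul, UMult.norm_lmul, StarAlgEquiv.norm_map]

theorem IsMeasurable.integrable_diracRight (hT : T.IsMeasurable μ) (z : G) (m : UMult A)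
    {f : G → A} (hf : Integrable f μ) : Integrable (T.diracRight z m f) μ := by
  have h1 : Integrable (fun x => f (x * z⁻¹)) μ := hf.comp_mul_right_inv z
  have hq := quasiMeasurePreserving_mul_right μ z⁻¹
  refine Integrable.smul (modularFunction z)⁻¹ ?_
  refine h1.congr' ?_ (Filter.Eventually.of_forall fun x => ?_)
  · refine ((hT.coc_right z).comp hq).rmul ?_
    exact StrictlyMeasurable.rmul ((StrictlyMeasurable.map_aut hT.1
      (StrictlyMeasurable.const m)).comp hq) h1.1
  · rw [UMult.norm_rmul, ← UMult.coe_map, UMult.norm_rmul]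

theorem IsMeasurable.integrable_invol (hT : T.IsMeasurable μ) {f : G → A} (hf : Integrable f μ) :
    Integrable (T.invol f) μ := by
  have h1 := hf.modularFunction_inv_smul_comp_inv
  refine h1.congr' ?_ (Filter.Eventually.of_forall fun x => ?_)
  · refine AEStronglyMeasurable.smul (𝕜 := ℝ) (f := fun x => (modularFunction x)⁻¹)
      measurable_modularFunction.inv.aestronglyMeasurable ?_
    refine hT.coc_inv.inv.lmul (aestronglyMeasurable_aut hT.1 ?_)
    exact continuous_star.comp_aestronglyMeasurable
      (hf.1.comp_quasiMeasurePreserving (quasiMeasurePreserving_inv μ))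
  · rw [invol, norm_smul, norm_smul, ← UMult.coe_inv, UMult.norm_lmul, StarAlgEquiv.norm_map,
      norm_star]

/-! ### The crossed product as a completion of `L¹(G; A)` -/

theorem IsMeasurable.exists_invol (hT : T.IsMeasurable μ) (f : G →₁[μ] A) :
    ∃ h : G →₁[μ] A, h =ᵐ[μ] T.invol f :=
  ⟨_, Integrable.coeFn_toL1 (hT.integrable_invol (L1.integrable_coeFn f))⟩

/-- The image of `L¹(G; A)` is already a ⋆-subalgebra, so it is dense in the C⋆-algebra that it
generates. -/
theorem IsMeasurable.denseRange_ofL1 (hT : T.IsMeasurable μ) : DenseRange (T.ofL1 μ) := by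
  let R : NonUnitalStarSubalgebra ℂ (T.AllReps μ) :=
    { carrier := Set.range (T.universalRep μ)
      add_mem' := by
        rintro _ _ ⟨f, rfl⟩ ⟨g, rfl⟩
        exact ⟨f + g, congrArg Subtype.val (map_add (T.ofL1Lin μ) f g)⟩
      zero_mem' := ⟨0, congrArg Subtype.val (map_zero (T.ofL1Lin μ))⟩
      smul_mem' := by
        rintro c _ ⟨f, rfl⟩
        exact ⟨c • f, congrArg Subtype.val (map_smul (T.ofL1Lin μ) c f)⟩
      mul_mem' := by
        rintro _ _ ⟨f, rfl⟩ ⟨g, rfl⟩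
        obtain ⟨h, hh⟩ := hT.exists_conv f g
        exact ⟨h, congrArg Subtype.val (ofL1_eq_mul hh)⟩
      star_mem' := by
        rintro _ ⟨f, rfl⟩
        obtain ⟨h, hh⟩ := hT.exists_invol f
        exact ⟨h, congrArg Subtype.val (ofL1_eq_star hh)⟩ }
  have hle : NonUnitalStarAlgebra.adjoin ℂ (Set.range (T.universalRep μ)) ≤ R :=
    NonUnitalStarAlgebra.adjoin_le (Set.Subset.refl _)
  intro F
  change F ∈ closure (Set.range (T.ofL1 μ))
  refine closure_subtype.2 ?_
  have hF : F.1 ∈ closure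
      (NonUnitalStarAlgebra.adjoin ℂ (Set.range (T.universalRep μ)) : Set (T.AllReps μ)) := F.2
  refine closure_mono ?_ hF
  intro a ha
  obtain ⟨f, rfl⟩ := hle ha
  exact ⟨T.ofL1 μ f, ⟨f, rfl⟩, rfl⟩

theorem IsMeasurable.secondCountableTopology (hT : T.IsMeasurable μ) :
    SecondCountableTopology (T.CrossedProduct μ) := by
  have : SecondCountableTopology (G →₁[μ] A) := L1.secondCountableTopology
  have : TopologicalSpace.SeparableSpace (T.CrossedProduct μ) :=
    hT.denseRange_ofL1.separableSpace continuous_ofL1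
  exact UniformSpace.secondCountable_of_separable _

/-! ### The multipliers `δ_z ⊗ m` -/

/-- Multipliers of the crossed product are determined by left multiplication on `L¹(G; A)`. -/
theorem IsMeasurable.mult_ext (hT : T.IsMeasurable μ) {M N : Mult (T.CrossedProduct μ)}
    (h : ∀ f, Mult.lmul M (T.ofL1 μ f) = Mult.lmul N (T.ofL1 μ f)) : M = N := by
  refine Mult.ext_lmul fun F => ?_
  refine hT.denseRange_ofL1.induction_on (p := fun F => Mult.lmul M F = Mult.lmul N F) F ?_ h
  exact isClosed_eq M.fst.continuous N.fst.continuous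

theorem IsMeasurable.exists_linearMap_diracLeft (hT : T.IsMeasurable μ) (z : G) (m : UMult A) :
    ∃ L : (G →₁[μ] A) →ₗ[ℂ] (G →₁[μ] A), ∀ f, L f =ᵐ[μ] T.diracLeft z m f :=
  L1.exists_linearMap (measurePreserving_mul_left μ z⁻¹).quasiMeasurePreserving
    (fun x => (T.coc z (z⁻¹ * x) : Mult A).snd ∘L (m : Mult A).fst ∘L autCLM (T.act z))
    (fun _ hf => hT.integrable_diracLeft z m hf)

theorem IsMeasurable.exists_linearMap_diracRight (hT : T.IsMeasurable μ) (z : G) (m : UMult A) :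
    ∃ R : (G →₁[μ] A) →ₗ[ℂ] (G →₁[μ] A), ∀ f, R f =ᵐ[μ] T.diracRight z m f :=
  L1.exists_linearMap (quasiMeasurePreserving_mul_right μ z⁻¹)
    (fun x => (modularFunction z)⁻¹ • ((T.coc (x * z⁻¹) z : Mult A).snd ∘L
      (Mult.map (T.act (x * z⁻¹)) m).snd))
    (fun _ hf => hT.integrable_diracRight z m hf)

/-- `δ_z ⊗ m` exists as a unitary multiplier, for unitary `m`. -/
theorem IsMeasurable.exists_isDiracTensor (hT : T.IsMeasurable μ) (z : G) (m : UMult A) :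
    ∃ U : UMult (T.CrossedProduct μ), T.IsDiracTensor μ z (m : Mult A) U := by
  obtain ⟨L, hL'⟩ := hT.exists_linearMap_diracLeft z m
  obtain ⟨R, hR'⟩ := hT.exists_linearMap_diracRight z m
  have hc : ∀ f g, T.ofL1 μ (R f) * T.ofL1 μ g = T.ofL1 μ f * T.ofL1 μ (L g) := fun f g => by
    obtain ⟨h, hh⟩ := hT.exists_conv (R f) g
    have e : T.conv μ (R f) g = T.conv μ f (L g) := by
      rw [conv_congr (Filter.EventuallyEq.refl _ f) (hL' g), conv_diracLeft]
      exact conv_congr (hR' f) (Filter.EventuallyEq.refl _ _)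
    rw [← ofL1_eq_mul hh, ofL1_eq_mul (hh.trans (.of_eq e))]
  have hi : ∀ f g, star (T.ofL1 μ (L f)) * T.ofL1 μ (L g) = star (T.ofL1 μ f) * T.ofL1 μ g := by
    intro f g
    obtain ⟨p, hp⟩ := hT.exists_invol f
    obtain ⟨q, hq⟩ := hT.exists_invol (L f)
    have h1 : q =ᵐ[μ] T.invol (T.diracLeft z m f) := hq.trans (invol_congr (hL' f))
    have h2 := diracRight_congr (T := T) z (m : Mult A) h1
    rw [diracRight_invol_diracLeft] at h2
    have h3 := (hR' q).trans h2
    have e : R q = p := Lp.ext (h3.trans hp.symm)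
    rw [← ofL1_eq_star hp, ← ofL1_eq_star hq, ← hc, e]
  have hi' : ∀ f g, T.ofL1 μ (R f) * star (T.ofL1 μ (R g)) = T.ofL1 μ f * star (T.ofL1 μ g) := by
    intro f g
    obtain ⟨p, hp⟩ := hT.exists_invol g
    obtain ⟨q, hq⟩ := hT.exists_invol (R g)
    have h1 : q =ᵐ[μ] T.invol (T.diracRight z m g) := hq.trans (invol_congr (hR' g))
    have h2 := diracLeft_congr (T := T) z (m : Mult A) h1
    rw [diracLeft_invol_diracRight] at h2
    have h3 := (hL' q).trans h2
    have e : L q = p := Lp.ext (h3.trans hp.symm)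
    rw [← ofL1_eq_star hp, ← ofL1_eq_star hq, hc, e]
  have hd : DenseRange (T.ofL1Lin μ) := hT.denseRange_ofL1
  obtain ⟨U, hU⟩ := UMult.exists_of_denseRange (T.ofL1Lin μ) hd L R hi hi' hc
  exact ⟨U, fun f => ⟨L f, hL' f, (hU f).1⟩, fun f => ⟨R f, hR' f, (hU f).2⟩⟩

/-- The unitary multiplier `δ_z ⊗ m` of the crossed product, for unitary `m`. -/
def IsMeasurable.dirac (hT : T.IsMeasurable μ) (z : G) (m : UMult A) :
    UMult (T.CrossedProduct μ) := (hT.exists_isDiracTensor z m).choose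

theorem IsMeasurable.isDiracTensor_dirac (hT : T.IsMeasurable μ) (z : G) (m : UMult A) :
    T.IsDiracTensor μ z (m : Mult A) (hT.dirac z m) := (hT.exists_isDiracTensor z m).choose_spec

theorem IsMeasurable.dirac_mul_dirac (hT : T.IsMeasurable μ) (z w : G) (m n : UMult A) :
    hT.dirac z m * hT.dirac w n =
      hT.dirac (z * w) (m * UMult.map (T.act z) n * T.coc z w) := by
  refine Subtype.ext (hT.mult_ext fun f => ?_)
  obtain ⟨g, hg, eg⟩ := (hT.isDiracTensor_dirac w n).exists_left f
  obtain ⟨h, hh, eh⟩ := (hT.isDiracTensor_dirac z m).exists_left g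
  rw [Submonoid.coe_mul, Mult.mul_lmul, eg, eh]
  refine ((hT.isDiracTensor_dirac _ _).lmul_eq ?_).symm
  refine (hh.trans (diracLeft_congr z m hg)).trans (Filter.Eventually.of_forall fun x => ?_)
  have := T.dirac_mul z w ((z * w)⁻¹ * x) m n (f ((z * w)⁻¹ * x))
  have e1 : w⁻¹ * (z⁻¹ * x) = (z * w)⁻¹ * x := by group
  have e2 : w * ((z * w)⁻¹ * x) = z⁻¹ * x := by group
  rw [e2] at this
  simp only [diracLeft, e1]
  exact this

theorem IsMeasurable.dirac_one (hT : T.IsMeasurable μ) : hT.dirac 1 1 = 1 := by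
  have := hT.dirac_mul_dirac 1 1 1 1
  rw [map_one, T.coc_one_left, mul_one, mul_one, mul_one] at this
  exact mul_eq_left.1 this

end ConvolutionAlgebra

end TwistedAction

namespace TwistedAction

section Multipliers

variable {G : Type u} {A : Type w} [Group G] [TopologicalSpace G] [IsTopologicalGroup G]
  [MeasurableSpace G] [BorelSpace G] [LocallyCompactSpace G] [SecondCountableTopology G]
  [NonUnitalCStarAlgebra A] [SecondCountableTopology A] {T : TwistedAction G A} {μ : Measure G}
  [μ.IsHaarMeasure] (hT : T.IsMeasurable μ)

/-! ### The embedding of `UM(A)` and the unitaries `λ_x` -/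

/-- The embedding `m ↦ δ_e ⊗ m` of unitary groups. -/
def IsMeasurable.embed : UMult A →* UMult (T.CrossedProduct μ) where
  toFun := hT.dirac 1
  map_one' := hT.dirac_one
  map_mul' m n := by
    rw [hT.dirac_mul_dirac, T.coc_one_left, mul_one, mul_one]
    congr 2
    exact Subtype.ext (Mult.map_of_id T.act_one _).symm

/-- The canonical unitary `λ_x = δ_x ⊗ 1` of the crossed product. -/
def IsMeasurable.lam (x : G) : UMult (T.CrossedProduct μ) := hT.dirac x 1

theorem IsMeasurable.lam_one : hT.lam 1 = 1 := hT.dirac_one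

theorem IsMeasurable.embed_mul_lam (m : UMult A) (x : G) :
    hT.embed m * hT.lam x = hT.dirac x m := by
  change hT.dirac 1 m * hT.dirac x 1 = _
  rw [hT.dirac_mul_dirac, T.coc_one_left, map_one, mul_one, mul_one, one_mul]

theorem IsMeasurable.lam_mul_embed (x : G) (m : UMult A) :
    hT.lam x * hT.embed m = hT.embed (UMult.map (T.act x) m) * hT.lam x := by
  rw [embed_mul_lam]
  change hT.dirac x 1 * hT.dirac 1 m = _
  rw [hT.dirac_mul_dirac, T.coc_one_right, one_mul, mul_one, mul_one]

theorem IsMeasurable.lam_mul_lam (x y : G) :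
    hT.lam x * hT.lam y = hT.embed (T.coc x y) * hT.lam (x * y) := by
  rw [embed_mul_lam]
  change hT.dirac x 1 * hT.dirac y 1 = _
  rw [hT.dirac_mul_dirac, map_one, one_mul, one_mul]

/-- The inner automorphism of `λ_x` extends `a_x` on the copy of `UM(A)`. -/
theorem IsMeasurable.map_lam_embed (x : G) (m : UMult A) :
    UMult.map (hT.lam x).adEquiv (hT.embed m) = hT.embed (UMult.map (T.act x) m) := by
  rw [UMult.map_adEquiv, lam_mul_embed, mul_inv_cancel_right]

end Multipliers

/-! ### Regularity of `m ↦ δ_e ⊗ m` and of `x ↦ λ_x` -/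

section Regularity

variable {G : Type u} {A : Type w} [Group G] [TopologicalSpace G] [IsTopologicalGroup G]
  [MeasurableSpace G] [BorelSpace G] [LocallyCompactSpace G] [SecondCountableTopology G]
  [NonUnitalCStarAlgebra A] [SecondCountableTopology A] {T : TwistedAction G A} {μ : Measure G}
  [μ.IsHaarMeasure] (hT : T.IsMeasurable μ) {X : Type*}

theorem IsMeasurable.strictlyContinuous_embed [TopologicalSpace X] [FirstCountableTopology X]
    {m : X → UMult A} (hm : StrictlyContinuous m) :
    StrictlyContinuous fun p => hT.embed (m p) := by
  refine .of_lmul (continuous_of_denseRange_of_isometry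
    (T := fun p => Mult.lmul (hT.embed (m p) : Mult (T.CrossedProduct μ)))
    (fun p => UMult.isometry_lmul _) hT.denseRange_ofL1 fun f => ?_)
  choose Φ hΦ e using fun p => (hT.isDiracTensor_dirac 1 (m p)).exists_left f
  refine (continuous_ofL1.comp (g := T.ofL1 μ) (f := Φ) (continuous_iff_continuousAt.2
    fun p₀ => ?_)).congr fun p => (e p).symm
  refine L1.continuousAt_of_dominated hΦ (L1.integrable_coeFn f).norm
    (Filter.Eventually.of_forall fun p => Filter.Eventually.of_forall fun y => ?_)
    (Filter.Eventually.of_forall fun y => ?_)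
  · rw [diracLeft_one, UMult.norm_lmul]
  · simp only [diracLeft_one]
    exact (hm _).1.continuousAt

theorem IsMeasurable.strictlyMeasurable_embed [MeasurableSpace X] {ρ : Measure X} [SFinite ρ]
    {m : X → UMult A} (hm : StrictlyMeasurable ρ m) :
    StrictlyMeasurable ρ fun p => hT.embed (m p) := by
  have := hT.secondCountableTopology
  have : SecondCountableTopology (G →₁[μ] A) := L1.secondCountableTopology
  refine .of_lmul (aestronglyMeasurable_of_denseRange
    (T := fun p => Mult.lmul (hT.embed (m p) : Mult (T.CrossedProduct μ)))
    (fun p => (UMult.isometry_lmul _).continuous) hT.denseRange_ofL1 fun f => ?_)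
  choose Φ hΦ e using fun p => (hT.isDiracTensor_dirac 1 (m p)).exists_left f
  refine (continuous_ofL1.comp_aestronglyMeasurable (g := T.ofL1 μ) (f := Φ) ?_).congr
    (Filter.Eventually.of_forall fun p => (e p).symm)
  refine L1.aestronglyMeasurable_of_prod hΦ ?_
  simp only [diracLeft_one]
  exact (hm.comp Measure.quasiMeasurePreserving_fst).lmul (Lp.aestronglyMeasurable f).comp_snd

theorem IsMeasurable.strictlyMeasurable_lam : StrictlyMeasurable μ hT.lam := by
  have := hT.secondCountableTopology
  have : SecondCountableTopology (G →₁[μ] A) := L1.secondCountableTopology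
  refine .of_lmul (aestronglyMeasurable_of_denseRange
    (T := fun p => Mult.lmul (hT.lam p : Mult (T.CrossedProduct μ)))
    (fun p => (UMult.isometry_lmul _).continuous) hT.denseRange_ofL1 fun f => ?_)
  choose Φ hΦ e using fun x => (hT.isDiracTensor_dirac x 1).exists_left f
  refine (continuous_ofL1.comp_aestronglyMeasurable (g := T.ofL1 μ) (f := Φ) ?_).congr
    (Filter.Eventually.of_forall fun p => (e p).symm)
  refine L1.aestronglyMeasurable_of_prod hΦ ?_
  have hK : AEStronglyMeasurable (fun p : G × G =>
      Mult.rmul (Mult.lmul ((1 : UMult A) : Mult A) (T.act p.1 (f p.2)))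
        (T.coc p.1 p.2 : Mult A)) (μ.prod μ) :=
    hT.2.rmul ((StrictlyMeasurable.const 1).lmul
      (aestronglyMeasurable_aut (φ := fun p : G × G => T.act p.1)
        (fun a => (hT.1 a).comp_fst) (Lp.aestronglyMeasurable f).comp_snd))
  exact hK.comp_quasiMeasurePreserving
    (measurePreserving_prod_inv_mul μ μ).quasiMeasurePreserving

/-- The classes of continuous functions of compact support have dense image in the crossed
product. -/
theorem IsMeasurable.denseRange_ofL1_compactlySupported (hT : T.IsMeasurable μ) :
    DenseRange fun f : {f : G →₁[μ] A // ∃ g : G → A, HasCompactSupport g ∧ Continuous g ∧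
      f =ᵐ[μ] g} => T.ofL1 μ f := by
  refine hT.denseRange_ofL1.comp (f := Subtype.val) (fun f => ?_) continuous_ofL1
  rw [Subtype.range_coe_subtype]
  refine Metric.mem_closure_iff.2 fun ε hε => ?_
  obtain ⟨g, hg, hfg, hc, hi⟩ :=
    (L1.integrable_coeFn f).exists_hasCompactSupport_integral_sub_le (half_pos hε)
  refine ⟨hi.toL1 g, ⟨g, hg, hc, hi.coeFn_toL1⟩, ?_⟩
  rw [dist_eq_norm, L1.norm_eq_integral_norm]
  refine lt_of_le_of_lt (le_of_eq_of_le (integral_congr_ae ?_) hfg) (half_lt_self hε)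
  filter_upwards [Lp.coeFn_sub f (hi.toL1 g), hi.coeFn_toL1] with y h1 h2
  rw [h1, Pi.sub_apply, h2]

open scoped Pointwise in
theorem IsMeasurable.strictlyContinuous_lam (hc : T.IsContinuous) :
    StrictlyContinuous hT.lam := by
  refine .of_lmul (continuous_of_denseRange_of_isometry
    (T := fun p => Mult.lmul (hT.lam p : Mult (T.CrossedProduct μ)))
    (fun p => UMult.isometry_lmul _) hT.denseRange_ofL1_compactlySupported fun f => ?_)
  obtain ⟨f, g, hgs, hgc, hfg⟩ := f
  choose Φ hΦ e using fun x => (hT.isDiracTensor_dirac x 1).exists_left f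
  refine (continuous_ofL1.comp (g := T.ofL1 μ) (f := Φ) (continuous_iff_continuousAt.2
    fun x₀ => ?_)).congr fun p => (e p).symm
  have hΦ' : ∀ x, Φ x =ᵐ[μ] T.diracLeft x ((1 : UMult A) : Mult A) g := fun x =>
    (hΦ x).trans (diracLeft_congr x _ hfg)
  have hn : ∀ x y, ‖T.diracLeft x ((1 : UMult A) : Mult A) g y‖ = ‖g (x⁻¹ * y)‖ := fun x y => by
    rw [diracLeft, UMult.norm_rmul, UMult.norm_lmul, StarAlgEquiv.norm_map]
  obtain ⟨K, hK, hKx⟩ := exists_compact_mem_nhds x₀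
  obtain ⟨C, hC⟩ := hgs.exists_bound_of_continuous hgc
  -- Near `x₀` all the functions are supported in the compact set `K · supp g`.
  set D := closure (K * tsupport g)
  have hD : IsCompact D := (hK.mul hgs).closure
  have hint : Integrable (D.indicator fun _ => C) μ :=
    (integrable_indicator_iff isClosed_closure.measurableSet).2
      (integrableOn_const hD.measure_ne_top)
  refine L1.continuousAt_of_dominated hΦ' hint ?_ (Filter.Eventually.of_forall fun y => ?_)
  · filter_upwards [hKx] with x hx
    refine Filter.Eventually.of_forall fun y => ?_
    rw [hn]
    by_cases hy : y ∈ D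
    · rw [Set.indicator_of_mem hy]
      exact hC _
    · rw [Set.indicator_of_notMem hy, norm_le_zero_iff]
      refine image_eq_zero_of_notMem_tsupport fun h => hy (subset_closure ?_)
      exact ⟨x, hx, x⁻¹ * y, h, mul_inv_cancel_left x y⟩
  · have h1 : Continuous fun x => T.act x (g (x⁻¹ * y)) :=
      continuous_apply_of_isometry (T := fun x a => T.act x a)
        (fun x => StarAlgEquiv.isometry _) hc.1 (by fun_prop)
    have h2 : StrictlyContinuous fun x => T.coc x (x⁻¹ * y) :=
      hc.2.comp (τ := fun x : G => (x, x⁻¹ * y)) (by fun_prop)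
    exact (h2.rmul (((1 : UMult A) : Mult A).fst.continuous.comp h1)).continuousAt

theorem IsContinuous.isMeasurable {H : Type*} [Group H] [TopologicalSpace H]
    [SecondCountableTopology H] [MeasurableSpace H] [BorelSpace H] {T : TwistedAction H A}
    (hc : T.IsContinuous) (μ : Measure H) : T.IsMeasurable μ :=
  ⟨fun b => (hc.1 b).aestronglyMeasurable, hc.2.strictlyMeasurable _⟩

end Regularity

end TwistedAction

/-! ### Inner automorphisms by unitary multipliers -/

namespace UMult

variable {A : Type w} [NonUnitalCStarAlgebra A]

theorem ad_mul (u v : UMult A) (a : A) : (u * v).ad a = u.ad (v.ad a) :=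
  Mult.of_injective <| by simp [of_ad, mul_assoc]

theorem ad_one (a : A) : (1 : UMult A).ad a = a :=
  Mult.of_injective <| by simp [of_ad]

theorem apply_ad (φ : A ≃⋆ₐ[ℂ] A) (u : UMult A) (a : A) : φ (u.ad a) = (map φ u).ad (φ a) :=
  Mult.of_injective <| by
    rw [of_ad, ← Mult.map_of, of_ad, Mult.map_mul, Mult.map_mul, Mult.map_star, Mult.map_of,
      coe_map]

theorem ad_eq_of_lmul_eq_rmul {u : UMult A} {a b : A}
    (h : Mult.lmul (u : Mult A) a = Mult.rmul b (u : Mult A)) : u.ad a = b :=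
  Mult.of_injective <| by
    rw [of_ad, ← Mult.of_lmul, h, Mult.of_rmul, mul_assoc, coe_mul_star_coe, mul_one]

end UMult

theorem Mult.map_eq_of_apply_lmul {A : Type w} [NonUnitalCStarAlgebra A] {φ : A ≃⋆ₐ[ℂ] A}
    {m n : Mult A} (h : ∀ a, φ (lmul m a) = lmul n (φ a)) : map φ m = n :=
  ext_lmul fun a => by rw [lmul_map, h, StarAlgEquiv.apply_symm_apply]

namespace CovariantStructure

/-! ### The action of the second group on `L¹(G; A)` -/

section Pointwise

variable {G : Type u} {Gt : Type v} {A : Type w} [Group G] [TopologicalSpace G]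
  [Group Gt] [TopologicalSpace Gt] [NonUnitalCStarAlgebra A] (S : CovariantStructure G Gt A)

/-- The operator `f ↦ ã_ξ[f(·)] κ(·, ξ)⋆` on functions. -/
def sndFun (ξ : Gt) (f : G → A) : G → A := fun y =>
  Mult.rmul (S.sndAct.act ξ (f y)) (star (S.kappa y ξ : Mult A))

/-- The inverse of `sndFun`. -/
def sndFunInv (ξ : Gt) (f : G → A) : G → A := fun y =>
  (S.sndAct.act ξ).symm (Mult.rmul (f y) (S.kappa y ξ : Mult A))

theorem sndFun_sndFunInv (ξ : Gt) (f : G → A) : S.sndFun ξ (S.sndFunInv ξ f) = f := by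
  funext y
  refine Mult.of_injective ?_
  simp [sndFun, sndFunInv, Mult.of_rmul, mul_assoc]

theorem sndFunInv_sndFun (ξ : Gt) (f : G → A) : S.sndFunInv ξ (S.sndFun ξ f) = f := by
  funext y
  have : Mult.rmul (S.sndFun ξ f y) (S.kappa y ξ : Mult A) = S.sndAct.act ξ (f y) :=
    Mult.of_injective <| by simp [sndFun, Mult.of_rmul, mul_assoc]
  rw [sndFunInv, this, StarAlgEquiv.symm_apply_apply]

theorem norm_sndFun (ξ : Gt) (f : G → A) (y : G) : ‖S.sndFun ξ f y‖ = ‖f y‖ := by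
  rw [sndFun, ← UMult.coe_inv, UMult.norm_rmul, StarAlgEquiv.norm_map]

theorem norm_sndFunInv (ξ : Gt) (f : G → A) (y : G) : ‖S.sndFunInv ξ f y‖ = ‖f y‖ := by
  rw [sndFunInv, StarAlgEquiv.norm_map, UMult.norm_rmul]

theorem of_act_comm (x : G) (ξ : Gt) (b : A) :
    Mult.of (S.fstAct.act x (S.sndAct.act ξ b)) = (S.kappa x ξ : Mult A) *
      (Mult.of (S.sndAct.act ξ (S.fstAct.act x b)) * star (S.kappa x ξ : Mult A)) := by
  rw [S.act_comm, UMult.of_ad, mul_assoc]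

theorem kappa_mul_map_fstCoc (x y : G) (ξ : Gt) :
    Mult.map (S.fstAct.act x) (star (S.kappa y ξ : Mult A)) * (S.fstAct.coc x y : Mult A) =
      (S.kappa x ξ : Mult A) * (Mult.map (S.sndAct.act ξ) (S.fstAct.coc x y : Mult A) *
        star (S.kappa (x * y) ξ : Mult A)) := by
  rw [S.act_fstCoc]
  simp [mul_assoc]

/-- The pointwise form of `b̃_ξ(f) ⋄ b̃_ξ(g) = b̃_ξ(f ⋄ g)`. -/
theorem snd_convolution_integrand (ξ : Gt) (y w : G) (a b : A) :
    Mult.rmul (Mult.rmul (S.sndAct.act ξ a) (star (S.kappa y ξ : Mult A)) *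
        S.fstAct.act y (Mult.rmul (S.sndAct.act ξ b) (star (S.kappa w ξ : Mult A))))
      (S.fstAct.coc y w : Mult A) =
    Mult.rmul (S.sndAct.act ξ (Mult.rmul (a * S.fstAct.act y b) (S.fstAct.coc y w : Mult A)))
      (star (S.kappa (y * w) ξ : Mult A)) := by
  refine Mult.of_injective ?_
  simp only [Mult.of_rmul, Mult.of_mul, Mult.of_apply_rmul, of_act_comm, mul_assoc,
    kappa_mul_map_fstCoc, UMult.star_coe_mul_coe_mul, map_mul]

/-- The pointwise form of `b̃_ξ(f)⋆ = b̃_ξ(f⋆)`. -/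
theorem snd_involution (ξ : Gt) (x : G) (b : A) :
    Mult.lmul (star (S.fstAct.coc x x⁻¹ : Mult A)) (S.fstAct.act x
      (star (Mult.rmul (S.sndAct.act ξ b) (star (S.kappa x⁻¹ ξ : Mult A))))) =
    Mult.rmul (S.sndAct.act ξ (Mult.lmul (star (S.fstAct.coc x x⁻¹ : Mult A))
      (S.fstAct.act x (star b)))) (star (S.kappa x ξ : Mult A)) := by
  refine Mult.of_injective ?_
  have h := congrArg star (S.act_fstCoc x x⁻¹ ξ)
  rw [mul_inv_cancel, S.kappa_one_left, OneMemClass.coe_one, mul_one, star_mul, star_mul,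
    star_star, ← Mult.map_star, ← Mult.map_star, star_star] at h
  rw [Mult.star_rmul, star_star, ← StarHomClass.map_star (S.sndAct.act ξ)]
  simp only [Mult.of_rmul, Mult.of_lmul, Mult.of_apply_lmul, of_act_comm, mul_assoc, h]

/-- The pointwise form of `b̃_ξ ∘ (δ_z ⊗ m) = (δ_z ⊗ ã_ξ(m) κ(z, ξ)⋆) ∘ b̃_ξ`. -/
theorem sndFun_diracLeft (ξ : Gt) (z : G) (m : Mult A) (f : G → A) :
    S.sndFun ξ (S.fstAct.diracLeft z m f) = S.fstAct.diracLeft z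
      (Mult.map (S.sndAct.act ξ) m * star (S.kappa z ξ : Mult A)) (S.sndFun ξ f) := by
  funext x
  have h := S.kappa_mul_map_fstCoc z (z⁻¹ * x) ξ
  rw [mul_inv_cancel_left] at h
  refine Mult.of_injective ?_
  simp only [sndFun, TwistedAction.diracLeft, Mult.of_rmul, Mult.of_lmul, Mult.of_apply_rmul,
    Mult.of_apply_lmul, of_act_comm, mul_assoc, h, UMult.star_coe_mul_coe_mul]

theorem map_fst_sndCoc_kappa (x : G) (ξ η : Gt) :
    star (S.kappa x ξ : Mult A) * Mult.map (S.fstAct.act x) (S.sndAct.coc ξ η : Mult A) =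
      Mult.map (S.sndAct.act ξ) (S.kappa x η : Mult A) *
        ((S.sndAct.coc ξ η : Mult A) * star (S.kappa x (ξ * η) : Mult A)) := by
  rw [S.act_sndCoc]
  simp [mul_assoc]

/-- The pointwise form of `(δ_e ⊗ α̃(ξ, η)) ⋄ b̃_{ξη}(f) = b̃_ξ(b̃_η(f)) ⋄ (δ_e ⊗ α̃(ξ, η))`. -/
theorem sndFun_sndFun (ξ η : Gt) (f : G → A) (y : G) :
    Mult.lmul (S.sndAct.coc ξ η : Mult A) (S.sndFun (ξ * η) f y) =
      Mult.rmul (S.sndFun ξ (S.sndFun η f) y)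
        (Mult.map (S.fstAct.act y) (S.sndAct.coc ξ η : Mult A)) := by
  refine Mult.of_injective ?_
  simp only [sndFun, Mult.of_rmul, Mult.of_lmul, Mult.of_apply_rmul, TwistedAction.of_act_act,
    mul_assoc, map_fst_sndCoc_kappa]
  rw [Mult.map_star, UMult.star_map_mul_map, UMult.star_coe_mul_coe_mul]

theorem invol_sndFun [IsTopologicalGroup G] [LocallyCompactSpace G] (ξ : Gt) (f : G → A) :
    S.fstAct.invol (S.sndFun ξ f) = S.sndFun ξ (S.fstAct.invol f) := by
  funext x
  simp only [TwistedAction.invol, sndFun]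
  rw [StarAlgEquiv.apply_real_smul, Mult.rmul_smul, snd_involution]

theorem kappa_continuous_left (ξ : Gt) : StrictlyContinuous fun y => S.kappa y ξ :=
  S.kappa_continuous.comp (τ := fun y : G => (y, ξ)) (by fun_prop)

theorem kappa_continuous_right (y : G) : StrictlyContinuous fun ξ => S.kappa y ξ :=
  S.kappa_continuous.comp (τ := fun ξ : Gt => (y, ξ)) (by fun_prop)

theorem sndFun_congr (ξ : Gt) [MeasurableSpace G] {μ : Measure G}
    {f g : G → A} (h : f =ᵐ[μ] g) :
    S.sndFun ξ f =ᵐ[μ] S.sndFun ξ g := by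
  filter_upwards [h] with y hy
  simp only [sndFun, hy]

theorem sndFunInv_congr (ξ : Gt) [MeasurableSpace G] {μ : Measure G}
    {f g : G → A} (h : f =ᵐ[μ] g) :
    S.sndFunInv ξ f =ᵐ[μ] S.sndFunInv ξ g := by
  filter_upwards [h] with y hy
  simp only [sndFunInv, hy]

theorem units_act_sndCoc (x : G) (ξ η : Gt) :
    UMult.map (S.fstAct.act x) (S.sndAct.coc ξ η) =
      S.kappa x ξ * UMult.map (S.sndAct.act ξ) (S.kappa x η) * S.sndAct.coc ξ η *
        (S.kappa x (ξ * η))⁻¹ := Subtype.ext (S.act_sndCoc x ξ η)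

theorem units_act_fstCoc (x y : G) (ξ : Gt) :
    UMult.map (S.sndAct.act ξ) (S.fstAct.coc x y) =
      (S.kappa x ξ)⁻¹ * UMult.map (S.fstAct.act x) (S.kappa y ξ)⁻¹ * S.fstAct.coc x y *
        S.kappa (x * y) ξ := Subtype.ext (S.act_fstCoc x y ξ)

theorem integrable_sndFun [SecondCountableTopology G] [MeasurableSpace G]
    [BorelSpace G] {μ : Measure G} (ξ : Gt) {f : G → A} (hf : Integrable f μ) :
    Integrable (S.sndFun ξ f) μ :=
  hf.congr' (((S.kappa_continuous_left ξ).strictlyMeasurable μ).inv.rmul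
      ((autCLM (S.sndAct.act ξ)).continuous.comp_aestronglyMeasurable hf.1))
    (Filter.Eventually.of_forall fun y => (S.norm_sndFun ξ f y).symm)

theorem integrable_sndFunInv [SecondCountableTopology G] [MeasurableSpace G]
    [BorelSpace G] {μ : Measure G} (ξ : Gt) {f : G → A} (hf : Integrable f μ) :
    Integrable (S.sndFunInv ξ f) μ :=
  hf.congr' ((autCLM (S.sndAct.act ξ).symm).continuous.comp_aestronglyMeasurable
      (((S.kappa_continuous_left ξ).strictlyMeasurable μ).rmul hf.1))
    (Filter.Eventually.of_forall fun y => (S.norm_sndFunInv ξ f y).symm)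

theorem exists_linearMap_sndFun [SecondCountableTopology G] [MeasurableSpace G] [BorelSpace G]
    {μ : Measure G} (ξ : Gt) :
    ∃ L : (G →₁[μ] A) →ₗ[ℂ] (G →₁[μ] A), ∀ f, L f =ᵐ[μ] S.sndFun ξ f :=
  L1.exists_linearMap (Measure.QuasiMeasurePreserving.id μ)
    (fun y => (star (S.kappa y ξ : Mult A)).snd ∘L autCLM (S.sndAct.act ξ))
    (fun _ hf => S.integrable_sndFun ξ hf)

theorem exists_linearMap_sndFunInv [SecondCountableTopology G] [MeasurableSpace G] [BorelSpace G]
    {μ : Measure G} (ξ : Gt) :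
    ∃ L : (G →₁[μ] A) →ₗ[ℂ] (G →₁[μ] A), ∀ f, L f =ᵐ[μ] S.sndFunInv ξ f :=
  L1.exists_linearMap (Measure.QuasiMeasurePreserving.id μ)
    (fun y => autCLM (S.sndAct.act ξ).symm ∘L (S.kappa y ξ : Mult A).snd)
    (fun _ hf => S.integrable_sndFunInv ξ hf)

end Pointwise

section CrossedProduct

variable {G : Type u} {Gt : Type v} {A : Type w} [Group G] [TopologicalSpace G]
  [IsTopologicalGroup G] [LocallyCompactSpace G] [SecondCountableTopology G] [MeasurableSpace G]
  [BorelSpace G] [Group Gt] [TopologicalSpace Gt] [NonUnitalCStarAlgebra A]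
  (S : CovariantStructure G Gt A) {μ : Measure G} [μ.IsHaarMeasure]

theorem conv_sndFun (hT : S.fstAct.IsMeasurable μ) (ξ : Gt) {f g : G → A} (hf : Integrable f μ)
    (hg : Integrable g μ) :
    S.fstAct.conv μ (S.sndFun ξ f) (S.sndFun ξ g) =ᵐ[μ] S.sndFun ξ (S.fstAct.conv μ f g) := by
  filter_upwards [(hT.integrable_conv_integrand hf hg).prod_right_ae] with x hx
  have h := ((star (S.kappa x ξ : Mult A)).snd ∘L
    autCLM (S.sndAct.act ξ)).integral_comp_comm hx
  refine Eq.trans (integral_congr_ae (Filter.Eventually.of_forall fun y => ?_)) h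
  have := S.snd_convolution_integrand ξ y (y⁻¹ * x) (f y) (g (y⁻¹ * x))
  rw [mul_inv_cancel_left] at this
  exact this

end CrossedProduct

end CovariantStructure

namespace TwistedAction.L1Rep

variable {G : Type u} {A : Type w} [Group G] [TopologicalSpace G] [IsTopologicalGroup G]
  [LocallyCompactSpace G] [MeasurableSpace G] [NonUnitalCStarAlgebra A] {T : TwistedAction G A}
  {μ : Measure G}

/-- The composition of a representation with a contractive endomorphism of the Banach ⋆-algebra
`L¹(G; A)`. -/
def comp (π : T.L1Rep μ) (Θ : (G →₁[μ] A) →ₗ[ℂ] (G →₁[μ] A))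
    (hconv : ∀ f g h : G →₁[μ] A, h =ᵐ[μ] T.conv μ f g → Θ h =ᵐ[μ] T.conv μ (Θ f) (Θ g))
    (hinvol : ∀ f h : G →₁[μ] A, h =ᵐ[μ] T.invol f → Θ h =ᵐ[μ] T.invol (Θ f))
    (hnorm : ∀ f, ‖Θ f‖ ≤ ‖f‖) : T.L1Rep μ where
  H := π.H
  map := π.map ∘ₗ Θ
  map_conv f g h H := π.map_conv _ _ _ (hconv f g h H)
  map_invol f h H := π.map_invol _ _ (hinvol f h H)
  norm_le f := (π.norm_le _).trans (hnorm f)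

end TwistedAction.L1Rep

namespace TwistedAction

variable {G : Type u} {A : Type w} [Group G] [TopologicalSpace G] [IsTopologicalGroup G]
  [LocallyCompactSpace G] [SecondCountableTopology G] [MeasurableSpace G] [BorelSpace G]
  [NonUnitalCStarAlgebra A] [SecondCountableTopology A] {T : TwistedAction G A} {μ : Measure G}
  [μ.IsHaarMeasure]

theorem IsMeasurable.map_eq_of_apply_lmul (hT : T.IsMeasurable μ)
    {φ : T.CrossedProduct μ ≃⋆ₐ[ℂ] T.CrossedProduct μ} {M N : Mult (T.CrossedProduct μ)}
    (h : ∀ f, φ (Mult.lmul M (T.ofL1 μ f)) = Mult.lmul N (φ (T.ofL1 μ f))) :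
    Mult.map φ M = N := by
  refine Mult.map_eq_of_apply_lmul fun F => ?_
  have hφ := (autCLM φ).continuous
  refine hT.denseRange_ofL1.induction_on (p := fun F => φ (Mult.lmul M F) = Mult.lmul N (φ F)) F
    ?_ h
  exact isClosed_eq (hφ.comp M.fst.continuous) (N.fst.continuous.comp hφ)

end TwistedAction

namespace CovariantStructure

variable {G : Type u} {Gt : Type v} {A : Type w} [Group G] [TopologicalSpace G]
  [IsTopologicalGroup G] [LocallyCompactSpace G] [SecondCountableTopology G] [MeasurableSpace G]
  [BorelSpace G] [Group Gt] [TopologicalSpace Gt] [NonUnitalCStarAlgebra A]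
  [SecondCountableTopology A] (S : CovariantStructure G Gt A) {μ : Measure G} [μ.IsHaarMeasure]

/-! ### The action of the second group on the crossed product -/

section SecondAction

variable {S}

/-- `b̃_ξ` extends to the crossed product: it is an isometric ⋆-automorphism of `L¹(G; A)`, so
composition with it permutes the representations that define the enveloping norm. -/
theorem exists_sndAut (hT : S.fstAct.IsMeasurable μ) (ξ : Gt) :
    ∃ φ : S.fstAct.CrossedProduct μ ≃⋆ₐ[ℂ] S.fstAct.CrossedProduct μ, ∀ f : G →₁[μ] A,
      ∃ h : G →₁[μ] A, h =ᵐ[μ] S.sndFun ξ f ∧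
        φ (S.fstAct.ofL1 μ f) = S.fstAct.ofL1 μ h := by
  obtain ⟨Θ, hΘ⟩ := S.exists_linearMap_sndFun (μ := μ) ξ
  obtain ⟨Θ', hΘ'⟩ := S.exists_linearMap_sndFunInv (μ := μ) ξ
  have h₁ : ∀ f, Θ (Θ' f) = f := fun f => Lp.ext <| by
    have h := S.sndFun_congr ξ (hΘ' f)
    rw [sndFun_sndFunInv] at h
    exact (hΘ _).trans h
  have h₂ : ∀ f, Θ' (Θ f) = f := fun f => Lp.ext <| by
    have h := S.sndFunInv_congr ξ (hΘ f)
    rw [sndFunInv_sndFun] at h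
    exact (hΘ' _).trans h
  have hn : ∀ f, ‖Θ f‖ = ‖f‖ := fun f => by
    rw [L1.norm_eq_integral_norm, L1.norm_eq_integral_norm]
    refine integral_congr_ae ?_
    filter_upwards [hΘ f] with y hy
    rw [hy, norm_sndFun]
  have hn' : ∀ f, ‖Θ' f‖ = ‖f‖ := fun f => by rw [← hn, h₁]
  have hconv : ∀ f g h : G →₁[μ] A, h =ᵐ[μ] S.fstAct.conv μ f g →
      Θ h =ᵐ[μ] S.fstAct.conv μ (Θ f) (Θ g) := fun f g h H => by
    rw [TwistedAction.conv_congr (hΘ f) (hΘ g)]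
    exact ((hΘ h).trans (S.sndFun_congr ξ H)).trans
      (S.conv_sndFun hT ξ (L1.integrable_coeFn f) (L1.integrable_coeFn g)).symm
  have hinvol : ∀ f h : G →₁[μ] A, h =ᵐ[μ] S.fstAct.invol f →
      Θ h =ᵐ[μ] S.fstAct.invol (Θ f) := fun f h H => by
    have h1 := TwistedAction.invol_congr (T := S.fstAct) (hΘ f)
    rw [invol_sndFun] at h1
    exact ((hΘ h).trans (S.sndFun_congr ξ H)).trans h1.symm
  have hconv' : ∀ f g h : G →₁[μ] A, h =ᵐ[μ] S.fstAct.conv μ f g →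
      Θ' h =ᵐ[μ] S.fstAct.conv μ (Θ' f) (Θ' g) := fun f g h H => by
    obtain ⟨k, hk⟩ := hT.exists_conv (Θ' f) (Θ' g)
    have h1 := hconv _ _ _ hk
    rw [h₁, h₁] at h1
    have h2 : h = Θ k := Lp.ext (H.trans h1.symm)
    rw [h2, h₂]
    exact hk
  have hinvol' : ∀ f h : G →₁[μ] A, h =ᵐ[μ] S.fstAct.invol f →
      Θ' h =ᵐ[μ] S.fstAct.invol (Θ' f) := fun f h H => by
    obtain ⟨k, hk⟩ := hT.exists_invol (Θ' f)
    have h1 := hinvol _ _ hk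
    rw [h₁] at h1
    have h2 : h = Θ k := Lp.ext (H.trans h1.symm)
    rw [h2, h₂]
    exact hk
  have hle : ∀ f, ‖S.fstAct.ofL1 μ (Θ f)‖ = ‖S.fstAct.ofL1 μ f‖ := fun f => by
    refine le_antisymm (TwistedAction.norm_ofL1_le_of_forall fun π =>
      ⟨π.comp Θ hconv hinvol fun f => (hn f).le, le_rfl⟩)
      (TwistedAction.norm_ofL1_le_of_forall fun π =>
        ⟨π.comp Θ' hconv' hinvol' fun f => (hn' f).le, ?_⟩)
    change ‖π.map f‖ ≤ ‖π.map (Θ' (Θ f))‖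
    rw [h₂]
  have hd : DenseRange (S.fstAct.ofL1Lin μ) := hT.denseRange_ofL1
  obtain ⟨φ, hφ⟩ := StarAlgEquiv.exists_of_denseRange (S.fstAct.ofL1Lin μ) hd Θ Θ'
    (fun f => by rw [h₁]) (fun f => by rw [h₂]) hle
    (fun f g => by
      obtain ⟨h, hh⟩ := hT.exists_conv f g
      exact ⟨h, TwistedAction.ofL1_eq_mul hh, TwistedAction.ofL1_eq_mul (hconv _ _ _ hh)⟩)
    (fun f => by
      obtain ⟨h, hh⟩ := hT.exists_invol f
      exact ⟨h, TwistedAction.ofL1_eq_star hh, TwistedAction.ofL1_eq_star (hinvol _ _ hh)⟩)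
  exact ⟨φ, fun f => ⟨Θ f, hΘ f, hφ f⟩⟩

/-- The automorphism `b̃_ξ` of the crossed product. -/
def sndAut (hT : S.fstAct.IsMeasurable μ) (ξ : Gt) :
    S.fstAct.CrossedProduct μ ≃⋆ₐ[ℂ] S.fstAct.CrossedProduct μ := (exists_sndAut hT ξ).choose

theorem exists_sndAut_ofL1 (hT : S.fstAct.IsMeasurable μ) (ξ : Gt) (f : G →₁[μ] A) :
    ∃ h : G →₁[μ] A, h =ᵐ[μ] S.sndFun ξ f ∧
      sndAut hT ξ (S.fstAct.ofL1 μ f) = S.fstAct.ofL1 μ h :=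
  (exists_sndAut hT ξ).choose_spec f

theorem sndAut_ofL1 (hT : S.fstAct.IsMeasurable μ) (ξ : Gt) {f h : G →₁[μ] A}
    (H : h =ᵐ[μ] S.sndFun ξ f) : sndAut hT ξ (S.fstAct.ofL1 μ f) = S.fstAct.ofL1 μ h := by
  obtain ⟨h', hh', e⟩ := exists_sndAut_ofL1 hT ξ f
  rw [e]
  exact congrArg _ (Lp.ext (hh'.trans H.symm))

/-- `b̃_ξ(δ_z ⊗ m) = δ_z ⊗ ã_ξ(m) κ(z, ξ)⋆`. Both the compatibility of `b̃` with the copy of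
`UM(A)` and its covariance on the unitaries `λ_x` are cases of it. -/
theorem map_sndAut_dirac (hT : S.fstAct.IsMeasurable μ) (ξ : Gt) (z : G) (m : UMult A) :
    UMult.map (sndAut hT ξ) (hT.dirac z m) =
      hT.dirac z (UMult.map (S.sndAct.act ξ) m * (S.kappa z ξ)⁻¹) := by
  refine Subtype.ext (hT.map_eq_of_apply_lmul fun f => ?_)
  obtain ⟨g, hg, eg⟩ := (hT.isDiracTensor_dirac z m).exists_left f
  obtain ⟨h, hh, eh⟩ := exists_sndAut_ofL1 hT ξ f
  obtain ⟨k, hk, ek⟩ := exists_sndAut_ofL1 hT ξ g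
  rw [eg, eh, ek]
  refine ((hT.isDiracTensor_dirac _ _).lmul_eq ?_).symm
  have h1 := S.sndFun_congr ξ hg
  rw [sndFun_diracLeft] at h1
  exact (hk.trans h1).trans (TwistedAction.diracLeft_congr z _ hh.symm)

theorem map_sndAut_embed (hT : S.fstAct.IsMeasurable μ) (ξ : Gt) (m : UMult A) :
    UMult.map (sndAut hT ξ) (hT.embed m) = hT.embed (UMult.map (S.sndAct.act ξ) m) := by
  refine (map_sndAut_dirac hT ξ 1 m).trans ?_
  rw [S.kappa_one_left, inv_one, mul_one]
  rfl

theorem map_sndAut_lam (hT : S.fstAct.IsMeasurable μ) (ξ : Gt) (x : G) :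
    UMult.map (sndAut hT ξ) (hT.lam x) = (hT.embed (S.kappa x ξ))⁻¹ * hT.lam x := by
  refine (map_sndAut_dirac hT ξ x 1).trans ?_
  rw [map_one, one_mul, ← map_inv, hT.embed_mul_lam]

theorem sndAut_one (hT : S.fstAct.IsMeasurable μ) (F : S.fstAct.CrossedProduct μ) :
    sndAut hT (1 : Gt) F = F := by
  refine hT.denseRange_ofL1.induction_on (p := fun F => sndAut hT (1 : Gt) F = F) F
    (isClosed_eq (autCLM (sndAut hT (1 : Gt))).continuous continuous_id) fun f => ?_
  refine sndAut_ofL1 hT 1 (Filter.Eventually.of_forall fun y => Mult.of_injective ?_)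
  simp [sndFun, S.kappa_one_right, S.sndAct.act_one, Mult.of_rmul]

theorem sndAut_sndAut (hT : S.fstAct.IsMeasurable μ) (ξ η : Gt) (F : S.fstAct.CrossedProduct μ) :
    sndAut hT ξ (sndAut hT η F) =
      (hT.embed (S.sndAct.coc ξ η)).ad (sndAut hT (ξ * η) F) := by
  refine hT.denseRange_ofL1.induction_on (p := fun F => sndAut hT ξ (sndAut hT η F) =
    (hT.embed (S.sndAct.coc ξ η)).ad (sndAut hT (ξ * η) F)) F ?_ fun f => ?_
  · exact isClosed_eq ((autCLM (sndAut hT ξ)).comp (autCLM (sndAut hT η))).continuous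
      ((autCLM (hT.embed (S.sndAct.coc ξ η)).adEquiv).comp
        (autCLM (sndAut hT (ξ * η)))).continuous
  · obtain ⟨g, hg, eg⟩ := exists_sndAut_ofL1 hT η f
    obtain ⟨h, hh, eh⟩ := exists_sndAut_ofL1 hT ξ g
    obtain ⟨k, hk, ek⟩ := exists_sndAut_ofL1 hT (ξ * η) f
    rw [eg, eh, ek]
    have hD := hT.isDiracTensor_dirac 1 (S.sndAct.coc ξ η)
    obtain ⟨l, hl, el⟩ := hD.exists_left k
    refine (UMult.ad_eq_of_lmul_eq_rmul ?_).symm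
    refine el.trans (hD.rmul_eq ?_).symm
    refine (hl.trans (TwistedAction.diracLeft_congr 1 _ hk)).trans ?_
    filter_upwards [hh, S.sndFun_congr ξ hg] with y h1 h2
    rw [TwistedAction.diracLeft_one, h1, h2, sndFun_sndFun]

end SecondAction

/-! ### The covariant structure of the crossed product -/

variable [SecondCountableTopology Gt]

/-- The covariant structure carried by the twisted crossed product. -/
def crossedProduct (hT : S.fstAct.IsMeasurable μ) :
    CovariantStructure G Gt (S.fstAct.CrossedProduct μ) where
  separable := by
    have := hT.secondCountableTopology
    infer_instance
  fstAct :=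
    { act := fun x => (hT.lam x).adEquiv
      coc := fun x y => hT.embed (S.fstAct.coc x y)
      act_one := fun F => by rw [hT.lam_one, UMult.adEquiv_apply, UMult.ad_one]
      act_act := fun x y F => by
        simp only [UMult.adEquiv_apply]
        rw [← UMult.ad_mul, ← UMult.ad_mul, hT.lam_mul_lam]
      coc_one_right := fun x => by rw [S.fstAct.coc_one_right, map_one]
      coc_one_left := fun x => by rw [S.fstAct.coc_one_left, map_one]
      cocycle := fun x y z => by
        have h := congrArg hT.embed (S.fstAct.cocycle_units x y z)
        rw [map_mul, map_mul, ← hT.map_lam_embed] at h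
        exact congrArg Subtype.val h }
  sndAct :=
    { act := fun ξ => sndAut hT ξ
      coc := fun ξ η => hT.embed (S.sndAct.coc ξ η)
      act_one := sndAut_one hT
      act_act := sndAut_sndAut hT
      coc_one_right := fun x => by rw [S.sndAct.coc_one_right, map_one]
      coc_one_left := fun x => by rw [S.sndAct.coc_one_left, map_one]
      cocycle := fun x y z => by
        have h := congrArg hT.embed (S.sndAct.cocycle_units x y z)
        rw [map_mul, map_mul, ← map_sndAut_embed hT] at h
        exact congrArg Subtype.val h }
  kappa := fun x ξ => hT.embed (S.kappa x ξ)
  kappa_continuous := hT.strictlyContinuous_embed S.kappa_continuous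
  kappa_one_left := fun ξ => by rw [S.kappa_one_left, map_one]
  kappa_one_right := fun x => by rw [S.kappa_one_right, map_one]
  act_comm := fun x ξ F => by
    simp only [UMult.adEquiv_apply]
    rw [UMult.apply_ad, map_sndAut_lam, ← UMult.ad_mul, mul_inv_cancel_left]
  act_sndCoc := fun x ξ η => by
    have h := congrArg hT.embed (S.units_act_sndCoc x ξ η)
    rw [← hT.map_lam_embed, map_mul, map_mul, map_mul, ← map_sndAut_embed hT, map_inv] at h
    exact congrArg Subtype.val h
  act_fstCoc := fun x y ξ => by
    have h := congrArg hT.embed (S.units_act_fstCoc x y ξ)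
    rw [← map_sndAut_embed hT, map_mul, map_mul, map_mul, ← hT.map_lam_embed, map_inv,
      map_inv] at h
    exact congrArg Subtype.val h

theorem isFirstGeneration_crossedProduct (hT : S.fstAct.IsMeasurable μ) :
    S.IsFirstGeneration μ (S.crossedProduct hT) hT.lam where
  lam_eq x := hT.isDiracTensor_dirac x 1
  kappa_eq x ξ := hT.isDiracTensor_dirac 1 (S.kappa x ξ)
  fstAct_eq _ _ := rfl
  fstCoc_eq x y := hT.isDiracTensor_dirac 1 (S.fstAct.coc x y)
  sndAct_eq ξ f := exists_sndAut_ofL1 hT ξ f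
  sndCoc_eq ξ η := hT.isDiracTensor_dirac 1 (S.sndAct.coc ξ η)

theorem isParticular_crossedProduct (hT : S.fstAct.IsMeasurable μ) :
    (S.crossedProduct hT).IsParticular hT.lam where
  rho_one := hT.lam_one
  covariance x ξ := congrArg Subtype.val (map_sndAut_lam hT ξ x)
  act_eq _ _ := rfl
  coc_eq x y := by
    have h : hT.embed (S.fstAct.coc x y) = hT.lam x * hT.lam y * (hT.lam (x * y))⁻¹ := by
      rw [hT.lam_mul_lam, mul_inv_cancel_right]
    exact congrArg Subtype.val h

/-! ### Regularity -/

theorem continuous_sndAut (hT : S.fstAct.IsMeasurable μ) (hc : S.sndAct.IsContinuous)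
    (F : S.fstAct.CrossedProduct μ) : Continuous fun ξ => sndAut hT ξ F := by
  refine continuous_of_denseRange_of_isometry (T := fun ξ F => sndAut hT ξ F)
    (fun ξ => StarAlgEquiv.isometry _) hT.denseRange_ofL1 (fun f => ?_) F
  choose Φ hΦ e using fun ξ => exists_sndAut_ofL1 hT ξ f
  refine (TwistedAction.continuous_ofL1.comp (g := S.fstAct.ofL1 μ) (f := Φ)
    (continuous_iff_continuousAt.2 fun ξ₀ => ?_)).congr fun p => (e p).symm
  refine L1.continuousAt_of_dominated hΦ (L1.integrable_coeFn f).norm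
    (Filter.Eventually.of_forall fun ξ => Filter.Eventually.of_forall fun y => ?_)
    (Filter.Eventually.of_forall fun y => ?_)
  · rw [norm_sndFun]
  · exact ((S.kappa_continuous_right y).inv.rmul (hc.1 (f y))).continuousAt

theorem isContinuousParticular_crossedProduct (hT : S.fstAct.IsMeasurable μ)
    (hS : S.IsContinuous) : (S.crossedProduct hT).IsContinuousParticular hT.lam := by
  have hl := hT.strictlyContinuous_lam hS.1
  exact ⟨S.isParticular_crossedProduct hT,
    ⟨⟨fun F => hl.inv.rmul (hl F).1, hT.strictlyContinuous_embed hS.1.2⟩,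
      ⟨S.continuous_sndAut hT hS.2, hT.strictlyContinuous_embed hS.2.2⟩⟩, hl⟩

variable [MeasurableSpace Gt] [BorelSpace Gt] (ν : Measure Gt) [SFinite ν]

theorem aestronglyMeasurable_sndAut (hT : S.fstAct.IsMeasurable μ) (hm : S.sndAct.IsMeasurable ν)
    (F : S.fstAct.CrossedProduct μ) : AEStronglyMeasurable (fun ξ => sndAut hT ξ F) ν := by
  have : SecondCountableTopology (G →₁[μ] A) := L1.secondCountableTopology
  refine aestronglyMeasurable_of_denseRange (T := fun ξ F => sndAut hT ξ F)
    (fun ξ => (StarAlgEquiv.isometry _).continuous) hT.denseRange_ofL1 (fun f => ?_) F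
  choose Φ hΦ e using fun ξ => exists_sndAut_ofL1 hT ξ f
  refine (TwistedAction.continuous_ofL1.comp_aestronglyMeasurable (g := S.fstAct.ofL1 μ)
    (f := Φ) ?_).congr (Filter.Eventually.of_forall fun p => (e p).symm)
  refine L1.aestronglyMeasurable_of_prod hΦ ?_
  have hκ : StrictlyContinuous fun p : Gt × G => S.kappa p.2 p.1 :=
    S.kappa_continuous.comp continuous_swap
  exact (hκ.strictlyMeasurable _).inv.rmul (aestronglyMeasurable_aut
    (φ := fun p : Gt × G => S.sndAct.act p.1) (fun a => (hm.1 a).comp_fst)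
    (Lp.aestronglyMeasurable f).comp_snd)

theorem isMeasurableParticular_crossedProduct (hS : S.IsMeasurable μ ν) :
    (S.crossedProduct hS.1).IsMeasurableParticular μ ν hS.1.lam := by
  have hl := hS.1.strictlyMeasurable_lam
  exact ⟨S.isParticular_crossedProduct hS.1,
    ⟨⟨fun F => hl.inv.rmul (hl F).1, hS.1.strictlyMeasurable_embed hS.1.2⟩,
      ⟨S.aestronglyMeasurable_sndAut ν hS.1 hS.2, hS.1.strictlyMeasurable_embed hS.2.2⟩⟩, hl⟩

end CovariantStructure

end

theorem theorem4p2
    {G : Type*} [Group G] [TopologicalSpace G] [IsTopologicalGroup G] [LocallyCompactSpace G]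
    [T2Space G] [SecondCountableTopology G] [MeasurableSpace G] [BorelSpace G]
    {Gt : Type*} [Group Gt] [TopologicalSpace Gt] [IsTopologicalGroup Gt]
    [LocallyCompactSpace Gt] [T2Space Gt] [SecondCountableTopology Gt] [MeasurableSpace Gt]
    [BorelSpace Gt]
    {A : Type*} [NonUnitalCStarAlgebra A]
    (μ : Measure G) [μ.IsHaarMeasure] (ν : Measure Gt) [ν.IsHaarMeasure]
    (S : CovariantStructure G Gt A) :
    (S.IsMeasurable μ ν →
      ∃ (S' : CovariantStructure G Gt (S.fstAct.CrossedProduct μ))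
        (lam : G → UMult (S.fstAct.CrossedProduct μ)),
        S.IsFirstGeneration μ S' lam ∧ S'.IsMeasurableParticular μ ν lam) ∧
    (S.IsContinuous →
      ∃ (S' : CovariantStructure G Gt (S.fstAct.CrossedProduct μ))
        (lam : G → UMult (S.fstAct.CrossedProduct μ)),
        S.IsFirstGeneration μ S' lam ∧ S'.IsContinuousParticular lam) := by
  have := S.separable
  have : SecondCountableTopology A := UniformSpace.secondCountable_of_separable A
  refine ⟨fun hS => ⟨S.crossedProduct hS.1, hS.1.lam, S.isFirstGeneration_crossedProduct hS.1,
    S.isMeasurableParticular_crossedProduct ν hS⟩, fun hS => ?_⟩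
  have hT : S.fstAct.IsMeasurable μ := hS.1.isMeasurable μ
  exact ⟨S.crossedProduct hT, hT.lam, S.isFirstGeneration_crossedProduct hT,
    S.isContinuousParticular_crossedProduct hT hS⟩
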